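/- Let $\mathcal H$ be a complex Hilbert space and $S(t)$, $t\ge 0$, a strongly continuous semigroup of bounded operators on $\mathcal H$ with $S(0)=I$ and generator $A$. Let $\omega_1$ be the infimum of all $\omega\in\mathbb R$ such that $\{\operatorname{Re} z>\omega\}\subset\rho(A)$ and $\sup_{\operatorname{Re} z>\omega}\|(z-A)^{-1}\|<\infty$, and for $\omega>\omega_1$ define $r(\omega)$ by $\frac1{r(\omega)}=\sup_{\operatorname{Re} z>\omega}\|(z-A)^{-1}\|$. Assume that $\omega_1<0$ and that $r(0)=1$. Let $0<m\in C^1([0,+\infty[)$ be such that $\|S(t)\|\le m(t)$ for all $t\ge 0$. For $a>0$ let $\lambda^{DR}(a,m)$ be the lowest eigenvalue of the self-adjoint realization in $L^2(]0,a[,m^2ds)$ of the operator $K_m=-m^{-2}\,\partial_s\circ m^2\partial_s-1$ with domain $\{u\in H^2(]0,a[):\ u(0)=0,\ u'(a)=u(a)\}$, and set $$a^*=a^*(m)=\sup\{\tilde a>0:\ \lambda^{DR}(a,m)>0\ \text{ for } 0<a<\tilde a\}.$$ Then $a^*\in\,]0,+\infty]$. If $a^*<+\infty$, let $u_0$ be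 a first eigenfunction of this Dirichlet–Robin realization in $]0,a^*[$; if $a^*=+\infty$, let $u_0$ be a nonzero solution of $K_mu_0=0$ on $]0,+\infty[$ with $u_0(0)=0$. Such a $u_0$ exists, and on $]0,+\infty[\,\cap\,]0,a^*]$ it has no zero and $\psi_0:=u_0'/u_0$ is positive. For all $a,b\in\,]0,+\infty[\,\cap\,]0,a^*]$ and all $t>a+b$, $$\|e^tS(t)\|\le e^{a+b}\,m(a)\,m(b)\,\psi_0(a)^{1/2}\,\psi_0(b)^{1/2}.$$ In particular, if $a^*<+\infty$, then $$\|e^tS(t)\|\le e^{2a^*}\,m(a^*)^2\qquad\text{for all } t>2a^*.$$ -/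

import Mathlib

open Set Filter Topology MeasureTheory

noncomputable section

namespace SemigroupBound

section Semigroup

variable {H : Type*} [NormedAddCommGroup H] [InnerProductSpace ℂ H]

/-- `S` restricted to `[0, ∞[` is a strongly continuous semigroup of bounded operators with
`S 0 = 1`. The values of `S` at negative times play no role. -/
structure IsC0Semigroup (S : ℝ → H →L[ℂ] H) : Prop where
  zero : S 0 = 1
  add : ∀ s t : ℝ, 0 ≤ s → 0 ≤ t → S (s + t) = (S s).comp (S t)
  continuous : ∀ x : H, ContinuousOn (fun t : ℝ => S t x) (Ici 0)

/-- `y` is the limit of `(S(h) x - x) / h` as `h ↓ 0`. -/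
def HasGeneratorValue (S : ℝ → H →L[ℂ] H) (x y : H) : Prop :=
  Tendsto (fun h : ℝ => ((h⁻¹ : ℝ) : ℂ) • (S h x - x)) (𝓝[>] 0) (𝓝 y)

theorem HasGeneratorValue.add {S : ℝ → H →L[ℂ] H} {x y x' y' : H}
    (h : HasGeneratorValue S x y) (h' : HasGeneratorValue S x' y') :
    HasGeneratorValue S (x + x') (y + y') := by
  refine (Tendsto.add h h').congr fun t => ?_
  rw [map_add, ← smul_add]
  congr 1
  abel

theorem HasGeneratorValue.smul {S : ℝ → H →L[ℂ] H} {x y : H} (c : ℂ)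
    (h : HasGeneratorValue S x y) : HasGeneratorValue S (c • x) (c • y) := by
  refine (Tendsto.const_smul h c).congr fun t => ?_
  rw [map_smul, ← smul_sub, smul_comm]

theorem HasGeneratorValue.zero (S : ℝ → H →L[ℂ] H) : HasGeneratorValue S 0 0 := by
  simp [HasGeneratorValue]

theorem HasGeneratorValue.unique {S : ℝ → H →L[ℂ] H} {x y y' : H}
    (h : HasGeneratorValue S x y) (h' : HasGeneratorValue S x y') : y = y' :=
  tendsto_nhds_unique h h'

/-- The generator `A` of `S`, with its natural domain: all `x` for which
`A x = lim_{h ↓ 0} (S(h) x - x) / h` exists. -/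
def generator (S : ℝ → H →L[ℂ] H) : H →ₗ.[ℂ] H where
  domain :=
    { carrier := {x | ∃ y, HasGeneratorValue S x y}
      add_mem' := fun ⟨_, h⟩ ⟨_, h'⟩ => ⟨_, h.add h'⟩
      zero_mem' := ⟨0, HasGeneratorValue.zero S⟩
      smul_mem' := fun c _ ⟨_, h⟩ => ⟨_, h.smul c⟩ }
  toFun :=
    { toFun := fun x => Classical.choose x.2
      map_add' := fun x x' =>
        (Classical.choose_spec (x + x').2).unique
          ((Classical.choose_spec x.2).add (Classical.choose_spec x'.2))
      map_smul' := fun c x =>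
        (Classical.choose_spec (c • x).2).unique ((Classical.choose_spec x.2).smul c) }

/-- The bounded operator `R` is the two-sided inverse `(z - A)⁻¹ : H → D(A)`. -/
def IsResolventAt (A : H →ₗ.[ℂ] H) (z : ℂ) (R : H →L[ℂ] H) : Prop :=
  (∀ y : H, ∃ hy : R y ∈ A.domain, z • R y - A ⟨R y, hy⟩ = y) ∧
    ∀ x : A.domain, R (z • (x : H) - A x) = x

/-- The resolvent set `ρ(A)`. -/
def resolventSet (A : H →ₗ.[ℂ] H) : Set ℂ := {z | ∃ R, IsResolventAt A z R}

open scoped Classical in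
/-- The resolvent `(z - A)⁻¹` for `z ∈ ρ(A)` (and `0` off the resolvent set). -/
def resolvent (A : H →ₗ.[ℂ] H) (z : ℂ) : H →L[ℂ] H :=
  if h : ∃ R, IsResolventAt A z R then Classical.choose h else 0

/-- `ω₁`: the infimum of the real `ω` such that the half-plane `Re z > ω` lies in `ρ(A)` and
`‖(z - A)⁻¹‖` is bounded there. -/
def omegaOne (A : H →ₗ.[ℂ] H) : EReal :=
  sInf {x : EReal | ∃ ω : ℝ, x = (ω : EReal) ∧ {z : ℂ | ω < z.re} ⊆ resolventSet A ∧
    BddAbove ((fun z => ‖resolvent A z‖) '' {z : ℂ | ω < z.re})}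

/-- `r(ω)`, given by `1 / r(ω) = sup_{Re z > ω} ‖(z - A)⁻¹‖`; used for `ω > ω₁`. -/
def resolventRate (A : H →ₗ.[ℂ] H) (ω : ℝ) : ℝ :=
  (sSup ((fun z => ‖resolvent A z‖) '' {z : ℂ | ω < z.re}))⁻¹

end Semigroup

section DirichletRobin

/-- `g` is the weak derivative of `f` on the open interval `]0, a[`. -/
def HasWeakDeriv (a : ℝ) (f g : ℝ → ℝ) : Prop :=
  ∀ φ : ℝ → ℝ, ContDiff ℝ (⊤ : ℕ∞) φ → HasCompactSupport φ → tsupport φ ⊆ Ioo 0 a →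
    ∫ s in Ioo 0 a, f s * deriv φ s = -∫ s in Ioo 0 a, g s * φ s

/-- `u ∈ H²(]0, a[)` with derivative `du`. Here `u` and `du` are the representatives that are
continuous on `[0, a]` (and hence square integrable), which give the boundary values. -/
structure MemH2 (a : ℝ) (u du : ℝ → ℝ) : Prop where
  cont : ContinuousOn u (Icc 0 a)
  cont_deriv : ContinuousOn du (Icc 0 a)
  weak : HasWeakDeriv a u du
  weak_deriv : ∃ ddu : ℝ → ℝ, MemLp ddu 2 (volume.restrict (Ioo 0 a)) ∧ HasWeakDeriv a du ddu

/-- `K_m u = f` on `]0, a[`, where `K_m = - m⁻² ∂ ∘ m² ∂ - 1` and `du = ∂ u`. -/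
def KEq (m : ℝ → ℝ) (a : ℝ) (u du f : ℝ → ℝ) : Prop :=
  ∃ w : ℝ → ℝ, HasWeakDeriv a (fun s => m s ^ 2 * du s) w ∧
    ∀ᵐ s ∂(volume.restrict (Ioo 0 a)), -(1 / m s ^ 2) * w s - u s = f s

/-- `u ∈ H²(]0, a[)` is a nonzero solution of `K_m u = lam u` on `]0, a[` with `u(0) = 0`. -/
structure IsDirichletSolution (m : ℝ → ℝ) (a lam : ℝ) (u du : ℝ → ℝ) : Prop where
  memH2 : MemH2 a u du
  dirichlet : u 0 = 0
  eqn : KEq m a u du (fun s => lam * u s)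
  ne_zero : ∃ s ∈ Ioo 0 a, u s ≠ 0

/-- `u` is an eigenfunction, with eigenvalue `lam`, of the Dirichlet-Robin realization of `K_m`
in `]0, a[`: the boundary conditions are `u(0) = 0` and `u'(a) = u(a)`. -/
def IsDREigenfunction (m : ℝ → ℝ) (a lam : ℝ) (u du : ℝ → ℝ) : Prop :=
  IsDirichletSolution m a lam u du ∧ du a = u a

/-- The lowest eigenvalue `λ^{DR}(a, m)` (the spectrum is discrete and bounded below). -/
def lambdaDR (m : ℝ → ℝ) (a : ℝ) : ℝ :=
  sInf {lam : ℝ | ∃ u du : ℝ → ℝ, IsDREigenfunction m a lam u du}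

/-- `a*(m) = sup {c > 0 ; λ^{DR}(a, m) > 0 for 0 < a < c}`, an element of `]0, ∞]`. -/
def aStar (m : ℝ → ℝ) : EReal :=
  sSup {x : EReal | ∃ c : ℝ, x = (c : EReal) ∧ 0 < c ∧ ∀ a : ℝ, 0 < a → a < c → 0 < lambdaDR m a}

/-- `u`, with derivative `du`, is the function `u₀` (unique up to a nonzero constant factor):
if `a* < ∞`, a first eigenfunction of the Dirichlet-Robin realization of `K_m` in `]0, a*[`;
if `a* = ∞`, a nonzero solution of `K_m u = 0` on `]0, ∞[` with `u(0) = 0`. -/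
def IsFirstEigenfunction (m : ℝ → ℝ) (u du : ℝ → ℝ) : Prop :=
  (∀ c : ℝ, aStar m = (c : EReal) → IsDREigenfunction m c (lambdaDR m c) u du) ∧
    (aStar m = ⊤ → ∀ c : ℝ, 0 < c → IsDirichletSolution m c 0 u du)

/-- The logarithmic derivative `ψ₀ = u₀' / u₀`. -/
def logDer (u du : ℝ → ℝ) (s : ℝ) : ℝ := du s / u s

end DirichletRobin

end SemigroupBound

end

/-!
If `Φ` is bounded and Lipschitz and vanishes on `]-∞, 0]`, then `w(t) = Φ(t) S(t) x` solves
`(∂_t - A) w = Φ'(t) S(t) x`. On the side of Laplace transforms this reads `(z - A) ŵ(z) = f̂(z)` with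
`f = Φ' S x` (`hasGeneratorValue_integral`), and since `‖(z - A)⁻¹‖ ≤ 1` for `Re z > 0`, Plancherel's
theorem for `H`-valued functions gives `∫ e^{-2 ω' t} (Φ² - Φ'²) ‖S(t) x‖² dt ≤ 0` for every `ω' > 0`
above the growth rate of `S` (`integral_energy_nonpos`).

Let `u` solve `K_m u = 0` with `u(0) = 0`, and let `p = m² u'`, so that `p' = - m² u`. The weight is
`u / u(a)` on `[0, a]`, a multiple of `e^s` on `[a, t - b]`, a multiple of `p(t - s)` on `[t - b, t]`
and a multiple of `e^{-s}` afterwards. As long as `u' ≥ u`, the quantity `Φ² - Φ'²` is nonpositive on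
`[0, a]`, where `‖S(s) x‖ ≤ m(s) ‖x‖`, nonnegative on `[t - b, t]`, where
`‖S(t) x‖ ≤ m(t - s) ‖S(s) x‖`, and zero elsewhere. Both remaining integrals reduce to that of
`(u p)' = m² (u'² - u²)`, and the estimate comes out with an additional factor `e^{ω' t}`
(`norm_le_of_growth`). That version lowers a positive growth rate of `S` by `1 / 2`, so after finitely
many uses the growth rate is nonpositive and `ω'` can tend to `0` (`norm_le_of_resolvent_le_one`);
the Gearhart-Prüss theorem is not needed separately.

It remains to identify `a*` with the first positive zero of `u' - u` (`aStar_cases`). Weak solutions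
are classical by the du Bois-Reymond lemma, and classical solutions are described by a Prüfer angle,
which depends continuously on the spectral parameter. So the Dirichlet-Robin eigenvalues in `]0, a[`
form the zero set of a continuous function, nonempty as long as `u' > u` on `]0, a]`, while
Picone's identity shows that no eigenvalue is negative as long as `u' ≥ u` (`one_le_of_robin`). Hence
`λ^{DR}(a) > 0` before the first zero of `u' - u`, and `λ^{DR}(a) = 0` there. The function `u₀` is a
multiple of `u`, so that `ψ₀ = u' / u`, which equals `1` at a finite `a*`.
-/

noncomputable section

namespace SemigroupBound

/-! ### Plancherel's theorem for integrable square-integrable functions -/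

section Plancherel
open FourierTransform SchwartzMap
open scoped ENNReal

/-- The `L²` Fourier transform of an integrable function is given by the Fourier integral. Both
define the same tempered distribution. -/
theorem fourier_toLp_ae_eq {E : Type*} [NormedAddCommGroup E] [InnerProductSpace ℂ E]
    [CompleteSpace E] {f : ℝ → E} (h1 : Integrable f) (h2 : MemLp f 2) :
    (𝓕 (h2.toLp f) : Lp E 2 (volume : Measure ℝ)) =ᵐ[volume] 𝓕 f := by
  have hcont : Continuous (𝓕 f) :=
    VectorFourier.fourierIntegral_continuous Real.continuous_fourierChar
      (by exact continuous_inner) h1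
  have hL : LocallyIntegrable (𝓕 (h2.toLp f) : Lp E 2 (volume : Measure ℝ)) volume :=
    (Lp.memLp _).locallyIntegrable (by norm_num)
  have hL' : LocallyIntegrable (𝓕 f) volume := hcont.locallyIntegrable
  refine ae_eq_of_integral_contDiff_smul_eq hL hL' fun g hg hgc => ?_
  have hg₁ : HasCompactSupport (Complex.ofRealCLM ∘ g) := hgc.comp_left rfl
  have hg₂ : ContDiff ℝ (⊤ : ℕ∞) (Complex.ofRealCLM ∘ g) := by fun_prop
  set φ : 𝓢(ℝ, ℂ) := hg₁.toSchwartzMap hg₂ with hφ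
  have key := congrArg (fun T => T φ) (Lp.fourier_toTemperedDistribution_eq (h2.toLp f))
  simp only [TemperedDistribution.fourier_apply, Lp.toTemperedDistribution_apply] at key
  have e1 : ∫ x, g x • (𝓕 (h2.toLp f) : Lp E 2 (volume : Measure ℝ)) x
      = ∫ x, φ x • (𝓕 (h2.toLp f) : Lp E 2 (volume : Measure ℝ)) x := by
    congr 1
  have e2 : ∫ x, g x • 𝓕 f x = ∫ x, φ x • 𝓕 f x := by
    congr 1
  rw [e1, e2, ← key]
  have e3 : ∫ x, (𝓕 φ : 𝓢(ℝ, ℂ)) x • (h2.toLp f) x = ∫ x, (𝓕 φ : 𝓢(ℝ, ℂ)) x • f x := by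
    apply integral_congr_ae
    filter_upwards [h2.coeFn_toLp] with x hx
    rw [hx]
  rw [e3]
  have := VectorFourier.integral_fourierIntegral_smul_eq_flip (μ := volume) (ν := volume)
    (e := Real.fourierChar) (L := innerₗ ℝ) (f := φ) (g := f) Real.continuous_fourierChar
    (by exact continuous_inner) φ.integrable h1
  simpa using! this

/-- Plancherel's theorem for the Fourier integral. -/
theorem eLpNorm_fourier_eq {E : Type*} [NormedAddCommGroup E] [InnerProductSpace ℂ E]
    [CompleteSpace E] {f : ℝ → E} (h1 : Integrable f) (h2 : MemLp f 2) :
    eLpNorm (𝓕 f) 2 volume = eLpNorm f 2 volume := by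
  rw [← eLpNorm_congr_ae (fourier_toLp_ae_eq h1 h2), ← eLpNorm_congr_ae h2.coeFn_toLp]
  have := Lp.norm_fourier_eq (h2.toLp f)
  rw [Lp.norm_def, Lp.norm_def] at this
  exact (ENNReal.toReal_eq_toReal_iff' (Lp.eLpNorm_ne_top _) (Lp.eLpNorm_ne_top _)).1 this

end Plancherel

/-! ### The weighted energy inequality for orbits of the semigroup -/

section Energy
open scoped NNReal FourierTransform

variable {H : Type*} [NormedAddCommGroup H] [InnerProductSpace ℂ H] {S : ℝ → H →L[ℂ] H}

theorem HasGeneratorValue.mem_domain {x y : H} (h : HasGeneratorValue S x y) :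
    x ∈ (generator S).domain := ⟨y, h⟩

theorem HasGeneratorValue.generator_eq {x y : H} (h : HasGeneratorValue S x y) :
    generator S ⟨x, h.mem_domain⟩ = y :=
  (Classical.choose_spec (⟨y, h⟩ : ∃ y, HasGeneratorValue S x y)).unique h

theorem IsResolventAt.apply_of_hasGeneratorValue {z : ℂ} {R : H →L[ℂ] H}
    (hR : IsResolventAt (generator S) z R) {x y : H} (h : HasGeneratorValue S x (z • x - y)) :
    R y = x := by
  have := hR.2 ⟨x, h.mem_domain⟩
  rw [h.generator_eq] at this
  simpa using this

/-- The orbit `t ↦ S(t) x` for `t > 0`, extended by zero to the whole line. -/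
def orbit (S : ℝ → H →L[ℂ] H) (x : H) : ℝ → H := (Ioi 0).indicator fun t => S t x

theorem orbit_of_pos (x : H) {t : ℝ} (ht : 0 < t) : orbit S x t = S t x :=
  indicator_of_mem (mem_Ioi.2 ht) _

theorem orbit_of_nonpos (x : H) {t : ℝ} (ht : t ≤ 0) : orbit S x t = 0 :=
  indicator_of_notMem (notMem_Ioi.2 ht) _

theorem IsC0Semigroup.aestronglyMeasurable_orbit (hS : IsC0Semigroup S) (x : H) :
    AEStronglyMeasurable (orbit S x) volume :=
  (aestronglyMeasurable_indicator_iff measurableSet_Ioi).2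
    (((hS.continuous x).mono Ioi_subset_Ici_self).aestronglyMeasurable measurableSet_Ioi)

theorem integrable_expDecay {δ : ℝ} (hδ : 0 < δ) (K : ℝ) :
    Integrable ((Ioi (0 : ℝ)).indicator fun t => K * Real.exp (-δ * t)) :=
  (integrable_indicator_iff measurableSet_Ioi).2 ((exp_neg_integrableOn_Ioi 0 hδ).const_mul K)

theorem norm_smul_orbit_le {M ω ω' : ℝ} (hM : ∀ t, 0 ≤ t → ‖S t‖ ≤ M * Real.exp (ω * t)) (x : H)
    {c K t : ℝ} (hK : 0 ≤ K) (hc : c ≤ K * Real.exp (-ω' * t)) :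
    c * ‖orbit S x t‖ ≤ (Ioi (0 : ℝ)).indicator
      (fun t => K * M * ‖x‖ * Real.exp (-(ω' - ω) * t)) t := by
  rcases le_or_gt t 0 with ht | ht
  · rw [orbit_of_nonpos x ht, indicator_of_notMem (notMem_Ioi.2 ht)]
    simp
  · rw [orbit_of_pos x ht, indicator_of_mem (mem_Ioi.2 ht)]
    calc c * ‖S t x‖ ≤ (K * Real.exp (-ω' * t)) * (M * Real.exp (ω * t) * ‖x‖) := by
          gcongr
          exact (S t).le_of_opNorm_le (hM t ht.le) x
      _ = K * M * ‖x‖ * (Real.exp (-ω' * t) * Real.exp (ω * t)) := by ring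
      _ = _ := by rw [← Real.exp_add]; congr 2; ring

theorem integrable_smul_orbit (hS : IsC0Semigroup S) {M ω ω' : ℝ}
    (hM : ∀ t, 0 ≤ t → ‖S t‖ ≤ M * Real.exp (ω * t)) (hω : ω < ω') (x : H) {g : ℝ → ℂ} {K : ℝ}
    (hK : 0 ≤ K) (hgm : AEStronglyMeasurable g volume)
    (hg : ∀ t, ‖g t‖ ≤ K * Real.exp (-ω' * t)) : Integrable fun t => g t • orbit S x t := by
  refine (integrable_expDecay (sub_pos.2 hω) (K * M * ‖x‖)).mono'
    (hgm.smul (hS.aestronglyMeasurable_orbit x)) (.of_forall fun t => ?_)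
  rw [norm_smul]
  exact norm_smul_orbit_le hM x hK (hg t)

theorem memLp_smul_orbit (hS : IsC0Semigroup S) {M ω ω' : ℝ}
    (hM : ∀ t, 0 ≤ t → ‖S t‖ ≤ M * Real.exp (ω * t)) (hω : ω < ω') (x : H) {g : ℝ → ℂ} {K : ℝ}
    (hK : 0 ≤ K) (hgm : AEStronglyMeasurable g volume)
    (hg : ∀ t, ‖g t‖ ≤ K * Real.exp (-ω' * t)) : MemLp (fun t => g t • orbit S x t) 2 := by
  have hsm := hgm.smul (hS.aestronglyMeasurable_orbit x)
  refine (memLp_two_iff_integrable_sq_norm hsm).2 ?_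
  refine (integrable_expDecay (show 0 < 2 * (ω' - ω) by linarith) ((K * M * ‖x‖) ^ 2)).mono'
    (hsm.norm.pow 2) (.of_forall fun t => ?_)
  have h := norm_smul_orbit_le hM x hK (hg t)
  rw [← norm_smul] at h
  rw [Real.norm_eq_abs, abs_of_nonneg (by positivity)]
  refine (pow_le_pow_left₀ (norm_nonneg _) h 2).trans (le_of_eq ?_)
  by_cases ht : t ∈ Ioi (0 : ℝ)
  · rw [indicator_of_mem ht, indicator_of_mem ht, mul_pow, ← Real.exp_nat_mul]
    congr 2
    push_cast
    ring
  · rw [indicator_of_notMem ht, indicator_of_notMem ht]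
    simp

/-- The Laplace transform `W` of `Φ(t) S(t) x` at `z` lies in the domain of the generator `A`, and
`(z - A) W` is the Laplace transform of `Φ'(t) S(t) x`. As `Φ` vanishes on `]-∞, 0]`, applying `S(h)`
translates the weight, and the difference quotient of the semigroup becomes one of the weight. -/
theorem hasGeneratorValue_integral [CompleteSpace H] (hS : IsC0Semigroup S) {M ω : ℝ} {z : ℂ}
    (hM : ∀ t, 0 ≤ t → ‖S t‖ ≤ M * Real.exp (ω * t)) (hω : ω < z.re) (x : H)
    {Φ : ℝ → ℝ} {C : ℝ≥0} (hΦ0 : ∀ t ≤ 0, Φ t = 0) (hΦb : ∀ t, |Φ t| ≤ C)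
    (hΦl : LipschitzWith C Φ) :
    HasGeneratorValue S (∫ t : ℝ, (Complex.exp (-z * t) * Φ t) • orbit S x t)
      (z • (∫ t : ℝ, (Complex.exp (-z * t) * Φ t) • orbit S x t) -
        ∫ t : ℝ, (Complex.exp (-z * t) * (deriv Φ t : ℝ)) • orbit S x t) := by
  set g : ℝ → ℂ := fun t => Complex.exp (-z * t) * Φ t with hg
  have hexp : ∀ t : ℝ, ‖Complex.exp (-z * t)‖ = Real.exp (-z.re * t) := fun t => by
    rw [Complex.norm_exp]; simp
  have hΦc : Continuous Φ := hΦl.continuous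
  have hgc : Continuous g := by fun_prop
  have hgb : ∀ t, ‖g t‖ ≤ C * Real.exp (-z.re * t) := by
    intro t
    rw [hg, norm_mul, hexp, mul_comm, Complex.norm_real]
    gcongr
    exact hΦb t
  have hdb : ∀ t, |deriv Φ t| ≤ C := fun t => norm_deriv_le_of_lipschitz hΦl
  have hdm : AEStronglyMeasurable (fun t : ℝ => Complex.exp (-z * t) * (deriv Φ t : ℝ)) volume := by
    have : Measurable (deriv Φ) := measurable_deriv Φ
    exact Measurable.aestronglyMeasurable (by fun_prop)
  have hdB : ∀ t : ℝ, ‖Complex.exp (-z * t) * (deriv Φ t : ℝ)‖ ≤ C * Real.exp (-z.re * t) := by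
    intro t
    rw [norm_mul, hexp, mul_comm, Complex.norm_real]
    gcongr
    exact hdb t
  have hgi := integrable_smul_orbit hS hM hω x C.2 hgc.aestronglyMeasurable hgb
  have hdi := integrable_smul_orbit hS hM hω x C.2 hdm hdB
  -- translation: `S(h)` shifts the weight `g` to the right
  have hshift : ∀ h : ℝ, 0 < h → S h (∫ t, g t • orbit S x t) = ∫ t, g (t - h) • orbit S x t := by
    intro h hh
    rw [← ContinuousLinearMap.integral_comp_comm _ hgi,
      ← integral_sub_right_eq_self (fun t => S h (g t • orbit S x t)) h]
    congr 1
    ext t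
    rcases le_or_gt (t - h) 0 with ht | ht
    · simp [hg, hΦ0 _ ht]
    · rw [orbit_of_pos x ht, orbit_of_pos x (by linarith), map_smul]
      have := hS.add h (t - h) hh.le ht.le
      rw [add_sub_cancel] at this
      rw [this]
      rfl
  have hgs : ∀ h : ℝ, 0 < h → Integrable fun t => g (t - h) • orbit S x t := by
    intro h hh
    refine integrable_smul_orbit hS hM hω x (K := C * Real.exp (z.re * h)) (by positivity)
      (by fun_prop) fun t => (hgb (t - h)).trans (le_of_eq ?_)
    rw [mul_assoc, ← Real.exp_add]
    congr 2
    ring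
  have hquot : ∀ h : ℝ, 0 < h → ((h⁻¹ : ℝ) : ℂ) • (S h (∫ t, g t • orbit S x t) -
      ∫ t, g t • orbit S x t) = ∫ t, (((h⁻¹ : ℝ) : ℂ) * (g (t - h) - g t)) • orbit S x t := by
    intro h hh
    rw [hshift h hh, ← integral_sub (hgs h hh) hgi, ← integral_smul]
    congr 1
    ext t
    rw [← sub_smul, smul_smul]
  have hlim : z • (∫ t, g t • orbit S x t) -
      ∫ t : ℝ, (Complex.exp (-z * t) * (deriv Φ t : ℝ)) • orbit S x t =
      ∫ t : ℝ, (z * g t - Complex.exp (-z * t) * (deriv Φ t : ℝ)) • orbit S x t := by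
    have hzi : Integrable fun t => z • g t • orbit S x t := hgi.smul z
    rw [← integral_smul, ← integral_sub hzi hdi]
    congr 1
    ext t
    rw [smul_smul, ← sub_smul]
  rw [HasGeneratorValue, hlim]
  refine Tendsto.congr'
    (f₁ := fun h : ℝ => ∫ t, (((h⁻¹ : ℝ) : ℂ) * (g (t - h) - g t)) • orbit S x t) ?_ ?_
  · filter_upwards [self_mem_nhdsWithin] with h hh
    exact (hquot h hh).symm
  refine tendsto_integral_filter_of_dominated_convergence ((Ioi (0 : ℝ)).indicator
      (fun t => (2 * ‖z‖ * C + C) * M * ‖x‖ * Real.exp (-(z.re - ω) * t))) ?_ ?_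
    (integrable_expDecay (sub_pos.2 hω) _) ?_
  · refine .of_forall fun h => ?_
    exact (Continuous.aestronglyMeasurable (by fun_prop)).smul (hS.aestronglyMeasurable_orbit x)
  · have hev : ∀ᶠ h in 𝓝[>] (0 : ℝ), ‖z‖ * h < 1 := by
      have : Tendsto (fun h : ℝ => ‖z‖ * h) (𝓝[>] 0) (𝓝 (‖z‖ * 0)) :=
        ((continuous_const.mul continuous_id).tendsto 0).mono_left nhdsWithin_le_nhds
      rw [mul_zero] at this
      exact this.eventually_lt_const one_pos
    filter_upwards [self_mem_nhdsWithin, hev] with h hh hzh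
    have hh' : 0 < h := hh
    refine .of_forall fun t => ?_
    rw [norm_smul]
    refine norm_smul_orbit_le hM x (by positivity) ?_
    have e : g (t - h) - g t = Complex.exp (-z * t) *
        ((Complex.exp (z * h) - 1) * Φ (t - h) + ((Φ (t - h) - Φ t : ℝ) : ℂ)) := by
      have : Complex.exp (-z * ((t - h : ℝ) : ℂ)) = Complex.exp (-z * t) * Complex.exp (z * h) := by
        rw [← Complex.exp_add]; congr 1; push_cast; ring
      simp only [hg, this]
      push_cast
      ring
    have b1 : ‖Complex.exp (z * h) - 1‖ ≤ 2 * (‖z‖ * h) := by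
      have hn : ‖z * (h : ℂ)‖ = ‖z‖ * h := by
        rw [norm_mul, Complex.norm_real, Real.norm_eq_abs, abs_of_pos hh']
      rw [← hn]
      exact Complex.norm_exp_sub_one_le (by rw [hn]; exact hzh.le)
    have b2 : |Φ (t - h) - Φ t| ≤ C * h := by
      have := hΦl.dist_le_mul (t - h) t
      rwa [Real.dist_eq, Real.dist_eq, sub_sub_cancel_left, abs_neg, abs_of_pos hh'] at this
    have b3 : ‖(Complex.exp (z * h) - 1) * Φ (t - h) + ((Φ (t - h) - Φ t : ℝ) : ℂ)‖ ≤
        (2 * ‖z‖ * C + C) * h := by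
      calc _ ≤ _ := norm_add_le _ _
        _ = ‖Complex.exp (z * h) - 1‖ * |Φ (t - h)| + |Φ (t - h) - Φ t| := by
          rw [norm_mul, Complex.norm_real, Complex.norm_real, Real.norm_eq_abs, Real.norm_eq_abs]
        _ ≤ 2 * (‖z‖ * h) * C + C * h := by
          gcongr
          exact hΦb _
        _ = _ := by ring
    rw [e, norm_mul, norm_mul, hexp, Complex.norm_real, Real.norm_eq_abs,
      abs_of_pos (inv_pos.2 hh')]
    calc h⁻¹ * (Real.exp (-z.re * t) * _) ≤
          h⁻¹ * (Real.exp (-z.re * t) * ((2 * ‖z‖ * C + C) * h)) := by gcongr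
      _ = _ := by field_simp
  -- Rademacher's theorem gives the pointwise limit almost everywhere
  · filter_upwards [hΦl.ae_differentiableAt_real] with t ht
    refine Tendsto.smul_const ?_ _
    have h1 : HasDerivAt g (-(z * g t - Complex.exp (-z * t) * (deriv Φ t : ℝ))) t := by
      have ha : HasDerivAt (fun s : ℝ => Complex.exp (-z * s))
          (Complex.exp (-z * t) * (-z * 1)) t :=
        ((Complex.ofRealCLM.hasDerivAt (x := t)).const_mul (-z)).cexp
      refine (ha.mul ht.hasDerivAt.ofReal_comp).congr_deriv ?_
      simp only [hg]
      ring
    have h2 : HasDerivAt (fun h : ℝ => g (t - h))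
        (z * g t - Complex.exp (-z * t) * (deriv Φ t : ℝ)) 0 := by
      have hs : HasDerivAt (fun h : ℝ => t - h) (-1) 0 := (hasDerivAt_id 0).const_sub t
      have h1' : HasDerivAt g (-(z * g t - Complex.exp (-z * t) * (deriv Φ t : ℝ))) (t - 0) := by
        rwa [sub_zero]
      refine (h1'.scomp 0 hs).congr_deriv ?_
      simp
    have h3 := (hasDerivAt_iff_tendsto_slope.1 h2).mono_left
      (nhdsWithin_mono 0 fun h (hh : 0 < h) => hh.ne')
    refine h3.congr fun h => ?_
    rw [slope_def_module, sub_zero, sub_zero, Complex.real_smul]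

/-- If `‖(z - A)⁻¹‖ ≤ 1` on the line `Re z = ω'`, to the right of the growth rate `ω`, then the
`L²` norm of `e^{-ω' t} Φ(t) S(t) x` is at most that of `e^{-ω' t} Φ'(t) S(t) x`, by Plancherel. -/
theorem integral_energy_nonpos [CompleteSpace H] (hS : IsC0Semigroup S) {M ω ω' : ℝ}
    (hM : ∀ t, 0 ≤ t → ‖S t‖ ≤ M * Real.exp (ω * t)) (hω : ω < ω')
    (hR : ∀ z : ℂ, z.re = ω' → ∃ R, IsResolventAt (generator S) z R ∧ ‖R‖ ≤ 1) (x : H)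
    {Φ : ℝ → ℝ} {C : ℝ≥0} (hΦ0 : ∀ t ≤ 0, Φ t = 0) (hΦb : ∀ t, |Φ t| ≤ C)
    (hΦl : LipschitzWith C Φ) :
    IntegrableOn (fun t => Real.exp (-ω' * t) ^ 2 * (Φ t ^ 2 - deriv Φ t ^ 2) * ‖S t x‖ ^ 2)
      (Ioi 0) ∧
    ∫ t in Ioi 0, Real.exp (-ω' * t) ^ 2 * (Φ t ^ 2 - deriv Φ t ^ 2) * ‖S t x‖ ^ 2 ≤ 0 := by
  have hΦc : Continuous Φ := hΦl.continuous
  have hdb : ∀ t, |deriv Φ t| ≤ C := fun t => norm_deriv_le_of_lipschitz hΦl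
  have hdm : Measurable (deriv Φ) := measurable_deriv Φ
  have hbd : ∀ {F : ℝ → ℝ}, (∀ t, |F t| ≤ C) →
      ∀ t, ‖((Real.exp (-ω' * t) * F t : ℝ) : ℂ)‖ ≤ C * Real.exp (-ω' * t) := by
    intro F hF t
    rw [Complex.norm_real, Real.norm_eq_abs, abs_mul, abs_of_pos (Real.exp_pos _), mul_comm]
    gcongr
    exact hF t
  have hm1 : AEStronglyMeasurable (fun t => ((Real.exp (-ω' * t) * Φ t : ℝ) : ℂ)) volume :=
    Continuous.aestronglyMeasurable (by fun_prop)
  have hm2 : AEStronglyMeasurable (fun t => ((Real.exp (-ω' * t) * deriv Φ t : ℝ) : ℂ)) volume :=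
    Measurable.aestronglyMeasurable (by fun_prop)
  have w1 := integrable_smul_orbit hS hM hω x C.2 hm1 (hbd hΦb)
  have w2 := memLp_smul_orbit hS hM hω x C.2 hm1 (hbd hΦb)
  have f1 := integrable_smul_orbit hS hM hω x C.2 hm2 (hbd hdb)
  have f2 := memLp_smul_orbit hS hM hω x C.2 hm2 (hbd hdb)
  set w : ℝ → H := fun t => ((Real.exp (-ω' * t) * Φ t : ℝ) : ℂ) • orbit S x t with hw
  set f : ℝ → H := fun t => ((Real.exp (-ω' * t) * deriv Φ t : ℝ) : ℂ) • orbit S x t with hf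
  -- the Fourier integral at `ξ` is the Laplace integral at `z = ω' + 2 π i ξ`
  have hF : ∀ (F : ℝ → ℝ) (ξ : ℝ),
      𝓕 (fun t => ((Real.exp (-ω' * t) * F t : ℝ) : ℂ) • orbit S x t) ξ =
      ∫ t : ℝ, (Complex.exp (-(⟨ω', 2 * Real.pi * ξ⟩ : ℂ) * t) * F t) • orbit S x t := by
    intro F ξ
    rw [Real.fourier_real_eq_integral_exp_smul]
    congr 1
    ext t
    rw [smul_smul]
    congr 1
    push_cast
    rw [← mul_assoc, ← Complex.exp_add]
    congr 2
    apply Complex.ext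
    all_goals simp
    ring
  have hle : ∀ ξ, ‖𝓕 w ξ‖ ≤ ‖𝓕 f ξ‖ := by
    intro ξ
    obtain ⟨R, hR1, hR2⟩ := hR ⟨ω', 2 * Real.pi * ξ⟩ rfl
    have := hR1.apply_of_hasGeneratorValue
      (hasGeneratorValue_integral (z := ⟨ω', 2 * Real.pi * ξ⟩) hS hM hω x hΦ0 hΦb hΦl)
    rw [hw, hf, hF Φ ξ, hF (deriv Φ) ξ, ← this]
    simpa using R.le_of_opNorm_le hR2 _
  have hnorm : eLpNorm w 2 volume ≤ eLpNorm f 2 volume := by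
    rw [← eLpNorm_fourier_eq w1 w2, ← eLpNorm_fourier_eq f1 f2]
    exact eLpNorm_mono hle
  have hint : ∫ t, ‖w t‖ ^ 2 ≤ ∫ t, ‖f t‖ ^ 2 := by
    rw [w2.eLpNorm_eq_integral_rpow_norm (by norm_num) (by norm_num),
      f2.eLpNorm_eq_integral_rpow_norm (by norm_num) (by norm_num)] at hnorm
    simp only [ENNReal.toReal_ofNat, Real.rpow_ofNat] at hnorm
    rwa [ENNReal.ofReal_le_ofReal_iff (by positivity),
      Real.rpow_le_rpow_iff (by positivity) (by positivity) (by norm_num)] at hnorm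
  have iw := (memLp_two_iff_integrable_sq_norm w1.1).1 w2
  have jf := (memLp_two_iff_integrable_sq_norm f1.1).1 f2
  have e : (fun t => ‖w t‖ ^ 2 - ‖f t‖ ^ 2) = (Ioi 0).indicator fun t =>
      Real.exp (-ω' * t) ^ 2 * (Φ t ^ 2 - deriv Φ t ^ 2) * ‖S t x‖ ^ 2 := by
    ext t
    simp only [hw, hf, norm_smul, Complex.norm_real, Real.norm_eq_abs, mul_pow, sq_abs]
    rcases le_or_gt t 0 with ht | ht
    · rw [indicator_of_notMem (notMem_Ioi.2 ht), orbit_of_nonpos x ht]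
      simp
    · rw [indicator_of_mem (mem_Ioi.2 ht), orbit_of_pos x ht]
      ring
  have hi : Integrable (fun t => ‖w t‖ ^ 2 - ‖f t‖ ^ 2) := iw.sub jf
  have hs : ∫ t, (‖w t‖ ^ 2 - ‖f t‖ ^ 2) ≤ 0 := by
    rw [integral_sub iw jf]
    linarith
  rw [e] at hi hs
  rw [integrable_indicator_iff measurableSet_Ioi] at hi
  rw [integral_indicator measurableSet_Ioi] at hs
  exact ⟨hi, hs⟩

end Energy

/-! ### Global solutions through the Prüfer angle -/

section ODE
open scoped NNReal

theorem exists_global_solution (f : ℝ → ℝ → ℝ) (x₀ : ℝ) (hcont : ∀ x, Continuous (f · x))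
    (hbound : ∀ T : ℝ, ∃ L : ℝ≥0, ∀ t ∈ Icc (-T) T, ∀ x, ‖f t x‖ ≤ L)
    (hlip : ∀ T : ℝ, ∃ K : ℝ≥0, ∀ t ∈ Icc (-T) T, LipschitzWith K (f t)) :
    ∃ θ : ℝ → ℝ, θ 0 = x₀ ∧ ∀ t, HasDerivAt θ (f t (θ t)) t := by
  have hloc : ∀ n : ℕ, ∃ α : ℝ → ℝ, α 0 = x₀ ∧
      ∀ t ∈ Ioo (-(n + 1 : ℝ)) (n + 1), HasDerivAt α (f t (α t)) t := by
    intro n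
    obtain ⟨L, hL⟩ := hbound (n + 1)
    obtain ⟨K, hK⟩ := hlip (n + 1)
    have hn : (0 : ℝ) ∈ Icc (-(n + 1 : ℝ)) (n + 1) := by
      constructor <;> linarith [n.cast_nonneg (α := ℝ)]
    have hp : IsPicardLindelof f (⟨0, hn⟩ : Icc (-(n + 1 : ℝ)) (n + 1)) x₀ (L * (n + 1)) 0 L K :=
      { lipschitzOnWith := fun t ht => (hK t ht).lipschitzOnWith
        continuousOn := fun x _ => (hcont x).continuousOn
        norm_le := fun t ht x _ => hL t ht x
        mul_max_le := by simp }
    obtain ⟨α, h0, h⟩ := hp.exists_eq_forall_mem_Icc_hasDerivWithinAt₀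
    exact ⟨α, h0, fun t ht => (h t (Ioo_subset_Icc_self ht)).hasDerivAt (Icc_mem_nhds ht.1 ht.2)⟩
  choose α h0 hα using hloc
  have huniq : ∀ n k : ℕ, n ≤ k → EqOn (α n) (α k) (Ioo (-(n + 1 : ℝ)) (n + 1)) := by
    intro n k hnk
    obtain ⟨K, hK⟩ := hlip (n + 1)
    have hnk' : (n : ℝ) ≤ k := by exact_mod_cast hnk
    refine ODE_solution_unique_of_mem_Ioo (v := f) (s := fun _ => univ) (K := K) (t₀ := 0)
      (fun t ht => (hK t (Ioo_subset_Icc_self ht)).lipschitzOnWith) ?_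
      (fun t ht => ⟨hα n t ht, trivial⟩)
      (fun t ht => ⟨hα k t ⟨by linarith [ht.1], by linarith [ht.2]⟩, trivial⟩) (by rw [h0, h0])
    constructor <;> linarith [n.cast_nonneg (α := ℝ)]
  -- the solutions on `]-(n + 1), n + 1[` agree on overlaps and glue to a global one
  refine ⟨fun t => α ⌈|t|⌉₊ t, by simp [h0], fun t => ?_⟩
  set n := ⌈|t|⌉₊ with hn
  have hmem : ∀ s, s ∈ Ioo (-((⌈|s|⌉₊ : ℝ) + 1)) ((⌈|s|⌉₊ : ℝ) + 1) := by
    intro s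
    have := abs_le.1 (Nat.le_ceil |s|)
    exact ⟨by linarith [this.1], by linarith [this.2]⟩
  have hev : (fun s => α ⌈|s|⌉₊ s) =ᶠ[𝓝 t] α n := by
    filter_upwards [isOpen_Ioo.mem_nhds (hmem t)] with s hs
    rcases le_total ⌈|s|⌉₊ n with h | h
    · exact huniq _ _ h (hmem s)
    · exact (huniq _ _ h hs).symm
  have := (hα n t (hmem t)).congr_of_eventuallyEq hev
  exact this

/-- The vector field of the Prüfer angle: if `(u, p) = ρ (sin θ, cos θ)` solves `u' = p / M²`,
`p' = - μ M² u`, then `θ' = cos² θ / M² + μ M² sin² θ`. It is bounded and globally Lipschitz in `θ`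
on bounded time intervals, so that its integral curves are global. -/
def prueferField (M : ℝ → ℝ) (μ t x : ℝ) : ℝ :=
  Real.cos x ^ 2 / M t ^ 2 + μ * M t ^ 2 * Real.sin x ^ 2

/-- `(u, p)` is the normalized solution, on the whole line, of the first-order system of
`-(M² u')' = μ M² u` with Dirichlet condition at `0`. Here `p = M² u'` and the normalization is
`p 0 = 1`; the eigenvalue parameter of `K_M` is `μ - 1`. -/
structure IsSolution (M : ℝ → ℝ) (μ : ℝ) (u p : ℝ → ℝ) : Prop where
  zero : u 0 = 0
  one : p 0 = 1
  deriv_u : ∀ t, HasDerivAt u (p t / M t ^ 2) t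
  deriv_p : ∀ t, HasDerivAt p (-μ * M t ^ 2 * u t) t

variable {M : ℝ → ℝ}

theorem exists_sq_bounds (hM : Continuous M) (hpos : ∀ t, 0 < M t) (T : ℝ) :
    ∃ c d : ℝ, 0 < c ∧ 0 < d ∧ ∀ t ∈ Icc (-T) T, c ≤ M t ^ 2 ∧ M t ^ 2 ≤ d := by
  rcases (Icc (-T) T).eq_empty_or_nonempty with h | h
  · exact ⟨1, 1, one_pos, one_pos, by simp [h]⟩
  · obtain ⟨x, hx, hx'⟩ := isCompact_Icc.exists_isMinOn h (hM.pow 2).continuousOn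
    obtain ⟨y, hy, hy'⟩ := isCompact_Icc.exists_isMaxOn h (hM.pow 2).continuousOn
    exact ⟨M x ^ 2, M y ^ 2, pow_pos (hpos x) 2, pow_pos (hpos y) 2, fun t ht => ⟨hx' ht, hy' ht⟩⟩

theorem prueferField_lipschitz (hM : Continuous M) (hpos : ∀ t, 0 < M t) (μ T : ℝ) :
    ∃ K : ℝ≥0, ∀ t ∈ Icc (-T) T, LipschitzWith K (prueferField M μ t) := by
  obtain ⟨c, d, hc, hd, h⟩ := exists_sq_bounds hM hpos T
  refine ⟨⟨2 / c + |μ| * d * 2, by positivity⟩, fun t ht => ?_⟩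
  obtain ⟨h1, h2⟩ := h t ht
  refine LipschitzWith.of_dist_le_mul fun x y => ?_
  have hM2 : 0 < M t ^ 2 := pow_pos (hpos t) 2
  have hcos : |Real.cos x ^ 2 - Real.cos y ^ 2| ≤ 2 * |x - y| := by
    rw [sq_sub_sq, abs_mul]
    have a1 : |Real.cos x + Real.cos y| ≤ 2 := by
      have := abs_add_le (Real.cos x) (Real.cos y)
      linarith [Real.abs_cos_le_one x, Real.abs_cos_le_one y]
    exact mul_le_mul a1 (Real.abs_cos_sub_cos_le x y) (abs_nonneg _) (by norm_num)
  have hsin : |Real.sin x ^ 2 - Real.sin y ^ 2| ≤ 2 * |x - y| := by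
    rw [Real.sin_sq, Real.sin_sq, show 1 - Real.cos x ^ 2 - (1 - Real.cos y ^ 2) =
      -(Real.cos x ^ 2 - Real.cos y ^ 2) by ring, abs_neg]
    exact hcos
  rw [Real.dist_eq, Real.dist_eq]
  have : prueferField M μ t x - prueferField M μ t y =
      (1 / M t ^ 2) * (Real.cos x ^ 2 - Real.cos y ^ 2) +
        μ * M t ^ 2 * (Real.sin x ^ 2 - Real.sin y ^ 2) := by
    unfold prueferField; ring
  rw [this]
  calc _ ≤ _ := abs_add_le _ _
    _ = (1 / M t ^ 2) * |Real.cos x ^ 2 - Real.cos y ^ 2| +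
        |μ| * M t ^ 2 * |Real.sin x ^ 2 - Real.sin y ^ 2| := by
      rw [abs_mul, abs_mul, abs_mul, abs_of_pos hM2, abs_of_pos (one_div_pos.2 hM2)]
    _ ≤ (1 / c) * (2 * |x - y|) + |μ| * d * (2 * |x - y|) := by
      gcongr
    _ = (2 / c + |μ| * d * 2) * |x - y| := by ring

theorem exists_pruefer (hM : Continuous M) (hpos : ∀ t, 0 < M t) (μ : ℝ) :
    ∃ θ : ℝ → ℝ, θ 0 = 0 ∧ ∀ t, HasDerivAt θ (prueferField M μ t (θ t)) t := by
  refine exists_global_solution (prueferField M μ) 0 (fun x => ?_) (fun T => ?_)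
    (prueferField_lipschitz hM hpos μ)
  · unfold prueferField
    have : ∀ t, M t ^ 2 ≠ 0 := fun t => (pow_pos (hpos t) 2).ne'
    fun_prop (disch := assumption)
  · obtain ⟨c, d, hc, hd, h⟩ := exists_sq_bounds hM hpos T
    refine ⟨⟨1 / c + |μ| * d, by positivity⟩, fun t ht x => ?_⟩
    obtain ⟨h1, h2⟩ := h t ht
    have hM2 : 0 < M t ^ 2 := pow_pos (hpos t) 2
    unfold prueferField
    calc _ ≤ _ := norm_add_le _ _
      _ = Real.cos x ^ 2 / M t ^ 2 + |μ| * M t ^ 2 * Real.sin x ^ 2 := by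
        rw [Real.norm_eq_abs, Real.norm_eq_abs, abs_mul, abs_mul, abs_of_nonneg (by positivity),
          abs_of_pos hM2, abs_of_nonneg (sq_nonneg (Real.sin x))]
      _ ≤ 1 / c + |μ| * d * 1 := by
        gcongr
        · exact Real.cos_sq_le_one x
        · exact Real.sin_sq_le_one x
      _ = 1 / c + |μ| * d := by rw [mul_one]

/-- The Prüfer radius belonging to the angle `θ`, normalized to be `1` at `0`. -/
def prueferRadius (M : ℝ → ℝ) (μ : ℝ) (θ : ℝ → ℝ) (t : ℝ) : ℝ :=
  Real.exp (∫ s in (0 : ℝ)..t, Real.sin (θ s) * Real.cos (θ s) * (1 / M s ^ 2 - μ * M s ^ 2))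

theorem prueferRadius_pos (μ : ℝ) (θ : ℝ → ℝ) (t : ℝ) : 0 < prueferRadius M μ θ t :=
  Real.exp_pos _

theorem isSolution_of_pruefer (hM : Continuous M) (hpos : ∀ t, 0 < M t) {μ : ℝ} {θ : ℝ → ℝ}
    (h0 : θ 0 = 0) (hθ : ∀ t, HasDerivAt θ (prueferField M μ t (θ t)) t) :
    IsSolution M μ (fun t => prueferRadius M μ θ t * Real.sin (θ t))
      (fun t => prueferRadius M μ θ t * Real.cos (θ t)) := by
  have hθc : Continuous θ := continuous_iff_continuousAt.2 fun t => (hθ t).continuousAt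
  have hne : ∀ t, M t ^ 2 ≠ 0 := fun t => (pow_pos (hpos t) 2).ne'
  have hgc : Continuous fun s =>
      Real.sin (θ s) * Real.cos (θ s) * (1 / M s ^ 2 - μ * M s ^ 2) := by
    fun_prop (disch := assumption)
  have hρ : ∀ t, HasDerivAt (prueferRadius M μ θ) (prueferRadius M μ θ t *
      (Real.sin (θ t) * Real.cos (θ t) * (1 / M t ^ 2 - μ * M t ^ 2))) t := fun t =>
    (intervalIntegral.integral_hasDerivAt_right (hgc.intervalIntegrable _ _)
      (hgc.stronglyMeasurableAtFilter _ _) hgc.continuousAt).exp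
  refine ⟨by simp [h0], by simp [h0, prueferRadius], fun t => ?_, fun t => ?_⟩
  · refine ((hρ t).mul (hθ t).sin).congr_deriv ?_
    have := Real.sin_sq_add_cos_sq (θ t)
    unfold prueferField
    have hs : Real.sin (θ t) ^ 2 = 1 - Real.cos (θ t) ^ 2 := by linarith
    have := (hpos t).ne'
    field_simp
    rw [hs]
    ring
  · refine ((hρ t).mul (hθ t).cos).congr_deriv ?_
    have := Real.sin_sq_add_cos_sq (θ t)
    unfold prueferField
    have hs : Real.cos (θ t) ^ 2 = 1 - Real.sin (θ t) ^ 2 := by linarith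
    have := (hpos t).ne'
    field_simp
    rw [hs]
    ring

/-- By Grönwall, the Prüfer angle at time `a` depends continuously on the spectral parameter. -/
theorem continuous_pruefer_param (hM : Continuous M) (hpos : ∀ t, 0 < M t) {θ : ℝ → ℝ → ℝ}
    (h0 : ∀ μ, θ μ 0 = 0) (hθ : ∀ μ t, HasDerivAt (θ μ) (prueferField M μ t (θ μ t)) t)
    {a : ℝ} (ha : 0 ≤ a) : Continuous fun μ => θ μ a := by
  refine continuous_iff_continuousAt.2 fun μ => ?_
  obtain ⟨K, hK⟩ := prueferField_lipschitz hM hpos μ a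
  obtain ⟨c, d, hc, hd, hb⟩ := exists_sq_bounds hM hpos a
  have hest : ∀ ν, dist (θ ν a) (θ μ a) ≤ gronwallBound 0 K (|ν - μ| * d) (a - 0) := by
    intro ν
    have hmem : ∀ t ∈ Ico 0 a, t ∈ Icc (-a) a := fun t ht => ⟨by linarith [ht.1], ht.2.le⟩
    have := dist_le_of_approx_trajectories_ODE_of_mem (v := prueferField M μ) (K := K)
      (s := fun _ => univ) (f := θ ν) (g := θ μ) (a := 0) (b := a) (εf := |ν - μ| * d) (εg := 0)
      (δ := 0) (fun t ht => (hK t (hmem t ht)).lipschitzOnWith)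
      (fun t _ => (hθ ν t).continuousAt.continuousWithinAt)
      (fun t _ => (hθ ν t).hasDerivWithinAt) ?_ (fun _ _ => trivial)
      (fun t _ => (hθ μ t).continuousAt.continuousWithinAt)
      (fun t _ => (hθ μ t).hasDerivWithinAt) (by simp) (fun _ _ => trivial) (by simp [h0])
      a (right_mem_Icc.2 ha)
    · simpa using this
    · intro t ht
      obtain ⟨-, h2⟩ := hb t (hmem t ht)
      rw [Real.dist_eq, show prueferField M ν t (θ ν t) - prueferField M μ t (θ ν t) =
        (ν - μ) * (M t ^ 2 * Real.sin (θ ν t) ^ 2) by unfold prueferField; ring, abs_mul]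
      gcongr
      rw [abs_of_nonneg (by positivity)]
      calc M t ^ 2 * Real.sin (θ ν t) ^ 2 ≤ d * 1 := by
            gcongr
            exact Real.sin_sq_le_one _
        _ = d := mul_one d
  refine tendsto_iff_dist_tendsto_zero.2 (squeeze_zero (fun _ => dist_nonneg) hest ?_)
  have hc' : Continuous fun ν : ℝ => gronwallBound 0 K (|ν - μ| * d) (a - 0) :=
    (gronwallBound_continuous_ε 0 K (a - 0)).comp (by fun_prop)
  have := hc'.tendsto μ
  simpa [gronwallBound_ε0_δ0] using this

/-- For a large spectral parameter the angle passes `π / 2` before time `a`: otherwise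
`arctan (k tan θ)`, with `k` a constant, would grow at least linearly at a rate proportional to `k`
while remaining below `π / 2`. -/
theorem exists_pruefer_ge (hM : Continuous M) (hpos : ∀ t, 0 < M t) {θ : ℝ → ℝ → ℝ}
    (h0 : ∀ μ, θ μ 0 = 0) (hθ : ∀ μ t, HasDerivAt (θ μ) (prueferField M μ t (θ μ t)) t)
    {a : ℝ} (ha : 0 < a) : ∃ μ, Real.pi / 2 ≤ θ μ a := by
  obtain ⟨c, d, hc, hd, hb⟩ := exists_sq_bounds hM hpos a
  -- `k` is chosen so that the lower bound `k / d` for the slope of `arctan (k tan θ)` gives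
  -- `2 > π / 2` at time `a`; `μ` is chosen so that `1 / M² + μ M² T² ≥ (1 + k² T²) / d`
  set k : ℝ := 2 * d / a with hk
  have hk0 : 0 < k := by positivity
  refine ⟨k ^ 2 / (c * d), ?_⟩
  set μ := k ^ 2 / (c * d) with hμ
  have hμ0 : 0 < μ := by positivity
  by_contra! hlt
  have hmono : Monotone (θ μ) := by
    refine monotone_of_hasDerivAt_nonneg (hθ μ) fun t => ?_
    simp only [prueferField, Pi.zero_apply]
    positivity
  have hrange : ∀ t ∈ Icc 0 a, 0 ≤ θ μ t ∧ θ μ t < Real.pi / 2 := fun t ht =>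
    ⟨by rw [← h0 μ]; exact hmono ht.1, (hmono ht.2).trans_lt hlt⟩
  have hcos : ∀ t ∈ Icc 0 a, 0 < Real.cos (θ μ t) := fun t ht =>
    Real.cos_pos_of_mem_Ioo ⟨by linarith [(hrange t ht).1, Real.pi_pos], (hrange t ht).2⟩
  have hder : ∀ t ∈ Icc 0 a, HasDerivAt (fun t => Real.arctan (k * Real.tan (θ μ t)))
      (1 / (1 + (k * Real.tan (θ μ t)) ^ 2) *
        (k * (1 / Real.cos (θ μ t) ^ 2 * prueferField M μ t (θ μ t)))) t := fun t ht =>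
    (((Real.hasDerivAt_tan (hcos t ht).ne').comp t (hθ μ t)).const_mul k).arctan
  have hge : ∀ t ∈ Icc 0 a, k / d ≤ 1 / (1 + (k * Real.tan (θ μ t)) ^ 2) *
        (k * (1 / Real.cos (θ μ t) ^ 2 * prueferField M μ t (θ μ t))) := by
    intro t ht
    obtain ⟨h1, h2⟩ := hb t ⟨by linarith [ht.1], ht.2⟩
    have hM2 : 0 < M t ^ 2 := pow_pos (hpos t) 2
    have hC := hcos t ht
    have e : 1 / Real.cos (θ μ t) ^ 2 * prueferField M μ t (θ μ t) =
        1 / M t ^ 2 + μ * M t ^ 2 * Real.tan (θ μ t) ^ 2 := by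
      unfold prueferField
      rw [Real.tan_eq_sin_div_cos]
      field_simp
    rw [e]
    have e2 : 1 / d * (1 + (k * Real.tan (θ μ t)) ^ 2) ≤
        1 / M t ^ 2 + μ * M t ^ 2 * Real.tan (θ μ t) ^ 2 := by
      have i1 : 1 / d ≤ 1 / M t ^ 2 := by gcongr
      have i2 : μ * c * Real.tan (θ μ t) ^ 2 ≤ μ * M t ^ 2 * Real.tan (θ μ t) ^ 2 := by gcongr
      have i3 : μ * c = k ^ 2 / d := by rw [hμ]; field_simp
      rw [i3] at i2
      calc _ = 1 / d + k ^ 2 / d * Real.tan (θ μ t) ^ 2 := by ring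
        _ ≤ _ := add_le_add i1 i2
    rw [one_div_mul_eq_div, le_div_iff₀ (by positivity)]
    calc k / d * (1 + (k * Real.tan (θ μ t)) ^ 2)
        = k * (1 / d * (1 + (k * Real.tan (θ μ t)) ^ 2)) := by ring
      _ ≤ _ := by gcongr
  have := (convex_Icc 0 a).mul_sub_le_image_sub_of_le_deriv
    (f := fun t => Real.arctan (k * Real.tan (θ μ t))) (C := k / d)
    (fun t ht => (hder t ht).continuousAt.continuousWithinAt)
    (fun t ht => (hder t (interior_subset ht)).differentiableAt.differentiableWithinAt)
    (fun t ht => by rw [(hder t (interior_subset ht)).deriv]; exact hge t (interior_subset ht))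
    0 (left_mem_Icc.2 ha.le) a (right_mem_Icc.2 ha.le) ha.le
  simp only [h0, Real.tan_zero, mul_zero, Real.arctan_zero, sub_zero] at this
  have h3 : k / d * a = 2 := by rw [hk]; field_simp
  linarith [Real.arctan_lt_pi_div_two (k * Real.tan (θ μ a)), Real.pi_lt_four]

end ODE

/-! ### Weak derivatives of continuous functions -/

section WeakDerivative
open scoped ContDiff

theorem hasWeakDeriv_of_hasDerivAt {a : ℝ} (ha : 0 ≤ a) {f g : ℝ → ℝ}
    (hf : ContinuousOn f (Icc 0 a)) (hg : ContinuousOn g (Icc 0 a))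
    (hd : ∀ t ∈ Ioo 0 a, HasDerivAt f (g t) t) : HasWeakDeriv a f g := by
  intro φ hφ _ hφs
  have hφ0 : ∀ t, t ∉ Ioo 0 a → φ t = 0 := fun t ht =>
    image_eq_zero_of_notMem_tsupport fun h => ht (hφs h)
  have hφd : Continuous (deriv φ) := hφ.continuous_deriv (by norm_num)
  have i1 : ContinuousOn (fun t => g t * φ t) (Icc 0 a) := hg.mul hφ.continuous.continuousOn
  have i2 : ContinuousOn (fun t => f t * deriv φ t) (Icc 0 a) := hf.mul hφd.continuousOn
  have key := intervalIntegral.integral_eq_sub_of_hasDerivAt_of_le ha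
    (f := fun t => f t * φ t) (f' := fun t => g t * φ t + f t * deriv φ t)
    (hf.mul hφ.continuous.continuousOn)
    (fun t ht => (hd t ht).mul (hφ.differentiable (by norm_num) t).hasDerivAt)
    ((i1.add i2).intervalIntegrable_of_Icc ha)
  rw [intervalIntegral.integral_add (i1.intervalIntegrable_of_Icc ha)
    (i2.intervalIntegrable_of_Icc ha), hφ0 a (by simp), hφ0 0 (by simp),
    intervalIntegral.integral_of_le ha, intervalIntegral.integral_of_le ha,
    integral_Ioc_eq_integral_Ioo, integral_Ioc_eq_integral_Ioo] at key
  linarith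

theorem HasWeakDeriv.congr {a : ℝ} {f g g' : ℝ → ℝ} (h : HasWeakDeriv a f g)
    (hg : ∀ᵐ s ∂(volume.restrict (Ioo 0 a)), g s = g' s) : HasWeakDeriv a f g' := by
  intro φ h1 h2 h3
  rw [h φ h1 h2 h3]
  congr 1
  refine integral_congr_ae ?_
  filter_upwards [hg] with s hs
  rw [hs]

/-- The du Bois-Reymond lemma: a continuous function with zero weak derivative is constant. -/
theorem eq_const_of_hasWeakDeriv_zero {a : ℝ} (ha : 0 < a) {h : ℝ → ℝ}
    (hc : ContinuousOn h (Icc 0 a))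
    (hw : HasWeakDeriv a h (fun _ => 0)) : ∀ t ∈ Icc 0 a, h t = h 0 := by
  -- a bump function in `]0, a[` of total mass one
  let b : ContDiffBump (a / 2) := ⟨a / 8, a / 4, by linarith, by linarith⟩
  set η : ℝ → ℝ := b.normed volume with hη
  have hηs : tsupport η ⊆ Ioo 0 a := by
    rw [hη, b.tsupport_normed_eq, Real.closedBall_eq_Icc]
    intro x hx
    simp only [b] at hx
    constructor <;> linarith [hx.1, hx.2]
  have hηd : ContDiff ℝ ∞ η := b.contDiff_normed
  have hηc : HasCompactSupport η := b.hasCompactSupport_normed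
  have hη1 : ∫ x, η x = 1 := b.integral_normed
  have hset : ∀ F : ℝ → ℝ, (∀ x, x ∉ Ioo 0 a → F x = 0) → ∫ s in Ioo 0 a, F s = ∫ s, F s :=
    fun F hF => setIntegral_eq_integral_of_forall_compl_eq_zero hF
  set k : ℝ := ∫ s, η s * h s with hk
  have hloc : LocallyIntegrableOn (fun x => h x - k) (Ioo 0 a) volume :=
    ((hc.sub continuousOn_const).locallyIntegrableOn measurableSet_Icc).mono_set Ioo_subset_Icc_self
  have hint : ∀ χ : ℝ → ℝ, Continuous χ → tsupport χ ⊆ Ioo 0 a →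
      Integrable (fun s => χ s * h s) := by
    intro χ hχ hχs
    have hon : IntegrableOn (fun s => χ s * h s) (Icc 0 a) :=
      (hχ.continuousOn.mul hc).integrableOn_Icc
    refine (integrableOn_iff_integrable_of_support_subset fun x hx => ?_).1 hon
    exact Ioo_subset_Icc_self (hχs (subset_tsupport _ (left_ne_zero_of_mul hx)))
  have hae := isOpen_Ioo.ae_eq_zero_of_integral_contDiff_smul_eq_zero hloc ?_
  · have hae' : h =ᵐ[volume.restrict (Icc 0 a)] fun _ => k := by
      rw [Filter.EventuallyEq, ← restrict_Ioo_eq_restrict_Icc,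
        ae_restrict_iff' measurableSet_Ioo]
      filter_upwards [hae] with x hx hxm
      exact sub_eq_zero.1 (hx hxm)
    have heq := Measure.eqOn_Icc_of_ae_eq volume ha.ne hae' hc continuousOn_const
    intro t ht
    rw [heq ht, heq (left_mem_Icc.2 ha.le)]
  intro χ hχ hχc hχs
  set c : ℝ := ∫ s, χ s with hcdef
  set ζ : ℝ → ℝ := fun s => χ s - c * η s with hζ
  have hζd : ContDiff ℝ ∞ ζ := hχ.sub (contDiff_const.mul hηd)
  have hζi : Integrable ζ := (hχ.continuous.integrable_of_hasCompactSupport hχc).sub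
    ((hηd.continuous.integrable_of_hasCompactSupport hηc).const_mul c)
  have hζ0 : ∫ s, ζ s = 0 := by
    rw [hζ, integral_sub (hχ.continuous.integrable_of_hasCompactSupport hχc)
      ((hηd.continuous.integrable_of_hasCompactSupport hηc).const_mul c),
      integral_const_mul, hη1, mul_one, sub_self]
  -- the primitive of `ζ` is a test function
  obtain ⟨x, y, hx0, hxy, hya, hsub⟩ : ∃ x y : ℝ, 0 < x ∧ x ≤ y ∧ y < a ∧
      ∀ s, s ∉ Icc x y → ζ s = 0 := by
    have hK : IsCompact (tsupport χ ∪ tsupport η) := hχc.isCompact.union hηc.isCompact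
    have hKs : tsupport χ ∪ tsupport η ⊆ Ioo 0 a := union_subset hχs hηs
    have hKn : (tsupport χ ∪ tsupport η).Nonempty := by
      refine ⟨a / 2, Or.inr ?_⟩
      rw [hη, b.tsupport_normed_eq]
      exact Metric.mem_closedBall_self (by simp only [b]; linarith)
    obtain ⟨x, hx⟩ := hK.exists_isLeast hKn
    obtain ⟨y, hy⟩ := hK.exists_isGreatest hKn
    refine ⟨x, y, (hKs hx.1).1, hx.2 hy.1, (hKs hy.1).2, fun s hs => ?_⟩
    have hsK : s ∉ tsupport χ ∪ tsupport η := fun hsK => hs ⟨hx.2 hsK, hy.2 hsK⟩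
    simp only [mem_union, not_or] at hsK
    simp [hζ, image_eq_zero_of_notMem_tsupport hsK.1, image_eq_zero_of_notMem_tsupport hsK.2]
  set φ : ℝ → ℝ := fun t => ∫ s in x..t, ζ s with hφ
  have hφ' : ∀ t, HasDerivAt φ (ζ t) t := fun t =>
    intervalIntegral.integral_hasDerivAt_right (hζd.continuous.intervalIntegrable _ _)
      (hζd.continuous.stronglyMeasurableAtFilter _ _) hζd.continuous.continuousAt
  have hdφ : deriv φ = ζ := funext fun t => (hφ' t).deriv
  have hφd : ContDiff ℝ ∞ φ := by
    rw [contDiff_infty_iff_deriv]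
    exact ⟨fun t => (hφ' t).differentiableAt, hdφ ▸ hζd⟩
  have hφs : ∀ t, t ∉ Icc x y → φ t = 0 := by
    intro t ht
    rw [mem_Icc, not_and_or, not_le, not_le] at ht
    rcases ht with ht | ht
    · refine (intervalIntegral.integral_congr_ae (g := fun _ => (0 : ℝ)) ?_).trans (by simp)
      filter_upwards [show ∀ᵐ s : ℝ, s ≠ x by simp [ae_iff]] with s hsx hs
      rw [uIoc_of_ge ht.le] at hs
      exact hsub s fun h => hsx (le_antisymm hs.2 h.1)
    · rw [hφ]
      simp only
      rw [intervalIntegral.integral_of_le (hxy.trans ht.le), ← integral_Icc_eq_integral_Ioc,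
        setIntegral_eq_integral_of_forall_compl_eq_zero, hζ0]
      intro s hs
      exact hsub s fun h => hs ⟨h.1, h.2.trans ht.le⟩
  have hφts : tsupport φ ⊆ Icc x y :=
    closure_minimal (fun t ht => by_contra fun h => ht (hφs t h)) isClosed_Icc
  have hφt : tsupport φ ⊆ Ioo 0 a := fun t ht =>
    ⟨hx0.trans_le (hφts ht).1, (hφts ht).2.trans_lt hya⟩
  have key := hw φ hφd (HasCompactSupport.of_support_subset_isCompact isCompact_Icc
    ((subset_tsupport _).trans hφts)) hφt
  rw [hdφ] at key
  simp only [zero_mul, integral_zero, neg_zero] at key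
  have hζI : ∀ s, s ∉ Ioo 0 a → ζ s = 0 := fun s hs =>
    hsub s fun h => hs ⟨hx0.trans_le h.1, h.2.trans_lt hya⟩
  rw [hset _ (fun s hs => by rw [hζI s hs, mul_zero])] at key
  have e1 : ∀ s, h s * ζ s = χ s * h s - c * (η s * h s) := fun s => by rw [hζ]; ring
  simp_rw [e1] at key
  rw [integral_sub (hint χ hχ.continuous hχs) ((hint η hηd.continuous hηs).const_mul c),
    integral_const_mul, ← hk] at key
  have e2 : ∀ s, χ s • (h s - k) = χ s * h s - χ s * k := fun s => by
    rw [smul_eq_mul]; ring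
  simp_rw [e2]
  rw [integral_sub (hint χ hχ.continuous hχs)
    ((hχ.continuous.integrable_of_hasCompactSupport hχc).mul_const k), integral_mul_const]
  exact key

theorem HasWeakDeriv.eq_integral {a : ℝ} (ha : 0 < a) {f g : ℝ → ℝ}
    (hf : ContinuousOn f (Icc 0 a)) (hg : ContinuousOn g (Icc 0 a)) (hw : HasWeakDeriv a f g) :
    ∀ t ∈ Icc 0 a, f t = f 0 + ∫ s in (0 : ℝ)..t, g s := by
  set G : ℝ → ℝ := fun t => ∫ s in (0 : ℝ)..t, g s with hG
  have hGc : ContinuousOn G (Icc 0 a) := by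
    have := intervalIntegral.continuousOn_primitive_interval (μ := volume) (f := g)
      (a := 0) (b := a)
      (by rw [uIcc_of_le ha.le]; exact hg.integrableOn_Icc)
    rwa [uIcc_of_le ha.le] at this
  have hGd : ∀ t ∈ Ioo 0 a, HasDerivAt G (g t) t := fun t ht =>
    intervalIntegral.integral_hasDerivAt_right
      ((hg.mono (Icc_subset_Icc_right ht.2.le)).intervalIntegrable_of_Icc ht.1.le)
      ((hg.mono Ioo_subset_Icc_self).stronglyMeasurableAtFilter isOpen_Ioo t ht)
      (hg.continuousAt (Icc_mem_nhds ht.1 ht.2))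
  have hGw := hasWeakDeriv_of_hasDerivAt ha.le hGc hg hGd
  have hw0 : HasWeakDeriv a (fun t => f t - G t) (fun _ => 0) := by
    intro φ h1 h2 h3
    have e := hw φ h1 h2 h3
    have e' := hGw φ h1 h2 h3
    have hφd : Continuous (deriv φ) := h1.continuous_deriv (by norm_num)
    have i : ∀ F : ℝ → ℝ, ContinuousOn F (Icc 0 a) →
        IntegrableOn (fun s => F s * deriv φ s) (Ioo 0 a) := fun F hF =>
      ((hF.mul hφd.continuousOn).integrableOn_Icc).mono_set Ioo_subset_Icc_self
    simp_rw [sub_mul]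
    rw [integral_sub (i f hf) (i G hGc), e, e']
    simp
  intro t ht
  have := eq_const_of_hasWeakDeriv_zero ha (hf.sub hGc) hw0 t ht
  simp only [hG, Pi.sub_apply, intervalIntegral.integral_same, sub_zero] at this ⊢
  linarith

end WeakDerivative

/-! ### Classical and weak solutions, and Picone's identity -/

section Classical

/-- The extension of `m : [0, ∞[ → ℝ` to the line that is constant on `]-∞, 0]`. It keeps continuity
and positivity, so that differential equations with this coefficient can be solved on the line. -/
def extendLeft (m : ℝ → ℝ) (t : ℝ) : ℝ := m (max t 0)

theorem extendLeft_of_nonneg (m : ℝ → ℝ) {t : ℝ} (ht : 0 ≤ t) : extendLeft m t = m t := by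
  rw [extendLeft, max_eq_left ht]

theorem continuous_extendLeft {m : ℝ → ℝ} (hm : ContinuousOn m (Ici 0)) :
    Continuous (extendLeft m) :=
  hm.comp_continuous (by fun_prop) fun t => le_max_right t 0

theorem extendLeft_pos {m : ℝ → ℝ} (hm : ∀ t, 0 ≤ t → 0 < m t) (t : ℝ) : 0 < extendLeft m t :=
  hm _ (le_max_right t 0)

namespace IsSolution

variable {M : ℝ → ℝ} {μ : ℝ} {u p : ℝ → ℝ}

theorem continuous_u (h : IsSolution M μ u p) : Continuous u :=
  continuous_iff_continuousAt.2 fun t => (h.deriv_u t).continuousAt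

theorem continuous_p (h : IsSolution M μ u p) : Continuous p :=
  continuous_iff_continuousAt.2 fun t => (h.deriv_p t).continuousAt

theorem tendsto_div (h : IsSolution M μ u p) :
    Tendsto (fun t => u t / t) (𝓝[>] 0) (𝓝 (1 / M 0 ^ 2)) := by
  have := (hasDerivAt_iff_tendsto_slope.1 (h.deriv_u 0)).mono_left
    (nhdsWithin_mono 0 fun t (ht : 0 < t) => ht.ne')
  rw [h.one] at this
  refine this.congr fun t => ?_
  rw [slope_def_field, h.zero, sub_zero, sub_zero]

theorem eventually_pos (h : IsSolution M μ u p) (hpos : ∀ t, 0 < M t) :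
    ∀ᶠ t in 𝓝[>] (0 : ℝ), 0 < u t := by
  have h0 : 0 < 1 / M 0 ^ 2 := by have := hpos 0; positivity
  filter_upwards [h.tendsto_div.eventually_const_lt h0, self_mem_nhdsWithin] with t ht ht'
  exact (div_pos_iff_of_pos_right ht').1 ht

theorem pos_of_lt (h : IsSolution M μ u p) (hpos : ∀ t, 0 < M t) {a : ℝ}
    (hlt : ∀ t, 0 < t → t < a → M t ^ 2 * u t < p t) {t : ℝ} (ht : 0 < t) (hta : t ≤ a) :
    0 < u t := by
  have hd : ∀ s, HasDerivAt (fun s => Real.exp (-s) * u s)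
      (Real.exp (-s) * -1 * u s + Real.exp (-s) * (p s / M s ^ 2)) s := fun s =>
    (hasDerivAt_neg s).exp.mul (h.deriv_u s)
  have hmono : StrictMonoOn (fun s => Real.exp (-s) * u s) (Icc 0 a) := by
    refine strictMonoOn_of_deriv_pos (convex_Icc 0 a)
      (fun s _ => (hd s).continuousAt.continuousWithinAt) fun s hs => ?_
    rw [interior_Icc] at hs
    have hM := pow_pos (hpos s) 2
    have h1 : u s < p s / M s ^ 2 := by
      rw [lt_div_iff₀ hM, mul_comm]
      exact hlt s hs.1 hs.2
    rw [(hd s).deriv]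
    nlinarith [Real.exp_pos (-s)]
  have := hmono ⟨le_rfl, ht.le.trans hta⟩ ⟨ht.le, hta⟩ ht
  simp only [h.zero, mul_zero] at this
  exact (mul_pos_iff_of_pos_left (Real.exp_pos _)).1 this

/-- A positive solution `u` for the parameter `1` that satisfies `u' ≥ u` at `a` excludes
Dirichlet-Robin eigenvalues of parameter `ν < 1`: if `v` is an eigenfunction, then
`v q - (p / u) v²` vanishes at `0`, is nonpositive at `a`, and has derivative
`(1 - ν) M² v² + (q - p v / u)² / M²` (Picone's identity). -/
theorem one_le_of_robin (hpos : ∀ t, 0 < M t) (h : IsSolution M 1 u p) {ν : ℝ} {v q : ℝ → ℝ}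
    (hv : IsSolution M ν v q) {a : ℝ} (ha : 0 < a) (hu : ∀ t, 0 < t → t ≤ a → 0 < u t)
    (hpa : M a ^ 2 * u a ≤ p a) (hq : q a = M a ^ 2 * v a) : 1 ≤ ν := by
  by_contra! hν
  set F : ℝ → ℝ := fun t => v t * q t - p t / u t * v t ^ 2 with hF
  have hd : ∀ t ∈ Ioc 0 a, HasDerivAt F ((1 - ν) * M t ^ 2 * v t ^ 2 +
      (q t - p t / u t * v t) ^ 2 / M t ^ 2) t := by
    intro t ht
    have hut := (hu t ht.1 ht.2).ne'
    have hM := (hpos t).ne'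
    refine (((hv.deriv_u t).mul (hv.deriv_p t)).sub
      (((h.deriv_p t).div (h.deriv_u t) hut).mul ((hv.deriv_u t).pow 2))).congr_deriv ?_
    simp only [Nat.cast_ofNat, Nat.add_one_sub_one, pow_one, Pi.div_apply, Pi.pow_apply]
    field_simp
    ring
  have hnn : ∀ t, 0 ≤ (1 - ν) * M t ^ 2 * v t ^ 2 + (q t - p t / u t * v t) ^ 2 / M t ^ 2 :=
    fun t => by
      have : 0 ≤ 1 - ν := by linarith
      positivity
  have hmono : MonotoneOn F (Ioc 0 a) := by
    refine monotoneOn_of_deriv_nonneg (convex_Ioc 0 a)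
      (fun t ht => (hd t ht).continuousAt.continuousWithinAt)
      (fun t ht => (hd t (interior_subset ht)).differentiableAt.differentiableWithinAt)
      fun t ht => ?_
    rw [(hd t (interior_subset ht)).deriv]
    exact hnn t
  have hlim : Tendsto F (𝓝[>] 0) (𝓝 0) := by
    have hM0 : 1 / M 0 ^ 2 ≠ 0 := by have := hpos 0; positivity
    have hc : ∀ {f : ℝ → ℝ}, Continuous f → Tendsto f (𝓝[>] 0) (𝓝 (f 0)) := fun hf =>
      hf.continuousAt.tendsto.mono_left nhdsWithin_le_nhds
    have := ((hc hv.continuous_u).mul (hc hv.continuous_p)).sub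
      ((hc h.continuous_p).mul ((hv.tendsto_div.div h.tendsto_div hM0).mul (hc hv.continuous_u)))
    rw [hv.zero, zero_mul, mul_zero, mul_zero, sub_zero] at this
    refine this.congr' ?_
    filter_upwards [self_mem_nhdsWithin] with t ht
    have ht' : t ≠ 0 := ne_of_gt ht
    simp only [hF, Pi.div_apply]
    rw [div_div_div_cancel_right₀ ht']
    ring
  have hFa : F a ≤ 0 := by
    have hua := hu a ha le_rfl
    have : M a ^ 2 ≤ p a / u a := by rwa [le_div_iff₀ hua]
    simp only [hF, hq]
    nlinarith [mul_le_mul_of_nonneg_right this (sq_nonneg (v a))]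
  have hF0 : ∀ t ∈ Ioc 0 a, F t = 0 := by
    intro t ht
    refine le_antisymm ((hmono ht (right_mem_Ioc.2 ha) ht.2).trans hFa) ?_
    refine le_of_tendsto hlim ?_
    filter_upwards [Ioo_mem_nhdsGT ht.1] with s hs
    exact hmono ⟨hs.1, hs.2.le.trans ht.2⟩ ht hs.2.le
  obtain ⟨t, hvt, ht⟩ := ((hv.eventually_pos hpos).and (Ioo_mem_nhdsGT ha)).exists
  have hz : HasDerivAt F 0 t := by
    refine (hasDerivAt_const t (0 : ℝ)).congr_of_eventuallyEq ?_
    filter_upwards [Ioo_mem_nhds ht.1 ht.2] with s hs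
    exact hF0 s (Ioo_subset_Ioc_self hs)
  have e := (hd t (Ioo_subset_Ioc_self ht)).unique hz
  have h1 : 0 < (1 - ν) * M t ^ 2 * v t ^ 2 := by
    have := hpos t
    have : 0 < 1 - ν := by linarith
    positivity
  have h2 : 0 ≤ (q t - p t / u t * v t) ^ 2 / M t ^ 2 := by positivity
  linarith

end IsSolution

/-- Weak Dirichlet solutions are the nonzero multiples of the normalized classical solution. -/
theorem IsDirichletSolution.eq_smul {m : ℝ → ℝ} (hm : ContinuousOn m (Ici 0))
    (hpos : ∀ t, 0 ≤ t → 0 < m t) {a lam : ℝ} (ha : 0 < a) {u du U P : ℝ → ℝ}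
    (h : IsDirichletSolution m a lam u du) (hs : IsSolution (extendLeft m) (1 + lam) U P) :
    ∃ k : ℝ, k ≠ 0 ∧ ∀ t ∈ Icc 0 a, u t = k * U t ∧ du t = k * (P t / m t ^ 2) := by
  have hmc : ContinuousOn m (Icc 0 a) := hm.mono Icc_subset_Ici_self
  have hM := continuous_extendLeft hm
  have hMpos := extendLeft_pos hpos
  have hu1 := h.memH2.weak.eq_integral ha h.memH2.cont h.memH2.cont_deriv
  obtain ⟨w, hw, hwe⟩ := h.eqn
  have hw' : HasWeakDeriv a (fun s => m s ^ 2 * du s) fun s => -(1 + lam) * m s ^ 2 * u s := by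
    refine hw.congr ?_
    filter_upwards [hwe, ae_restrict_mem measurableSet_Ioo] with s hs hs'
    have := (hpos s hs'.1.le).ne'
    field_simp at hs
    linarith
  have hpc : ContinuousOn (fun s => m s ^ 2 * du s) (Icc 0 a) := (hmc.pow 2).mul h.memH2.cont_deriv
  have hgc : ContinuousOn (fun s => -(1 + lam) * m s ^ 2 * u s) (Icc 0 a) :=
    (continuousOn_const.mul (hmc.pow 2)).mul h.memH2.cont
  have hp1 := hw'.eq_integral ha hpc hgc
  have hder : ∀ {f g : ℝ → ℝ}, ContinuousOn g (Icc 0 a) →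
      (∀ t ∈ Icc 0 a, f t = f 0 + ∫ s in (0 : ℝ)..t, g s) → ∀ t ∈ Ico 0 a,
      HasDerivWithinAt f (g t) (Ici t) t := by
    intro f g hg hf t ht
    have hI : HasDerivWithinAt (fun t => f 0 + ∫ s in (0 : ℝ)..t, g s) (g t) (Ici t) t := by
      refine (intervalIntegral.integral_hasDerivWithinAt_right
        ((hg.mono (Icc_subset_Icc_right ht.2.le)).intervalIntegrable_of_Icc ht.1)
        (s := Ici t) (t := Ioi t) ?_ ?_).const_add _
      · have : ContinuousOn g (Ioo t a) := hg.mono fun x hx => ⟨ht.1.trans hx.1.le, hx.2.le⟩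
        exact ⟨Ioo t a, Ioo_mem_nhdsGT ht.2, this.aestronglyMeasurable measurableSet_Ioo⟩
      · exact ((hg t ⟨ht.1, ht.2.le⟩).mono_of_mem_nhdsWithin
          (mem_of_superset (Ico_mem_nhdsGE ht.2)
            fun x hx => ⟨ht.1.trans hx.1, hx.2.le⟩)).mono Ioi_subset_Ici_self
    refine hI.congr_of_eventuallyEq ?_ (hf t ⟨ht.1, ht.2.le⟩)
    filter_upwards [Ico_mem_nhdsGE ht.2] with x hx
    exact hf x ⟨ht.1.trans hx.1, hx.2.le⟩
  set k : ℝ := m 0 ^ 2 * du 0 with hk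
  obtain ⟨c, d, hc, hd, hb⟩ := exists_sq_bounds hM hMpos a
  -- the difference of the two solutions has zero Cauchy data
  have hzero := eq_zero_of_abs_deriv_le_mul_abs_self_of_eq_zero_right
    (f := fun t => (u t - k * U t, m t ^ 2 * du t - k * P t))
    (f' := fun t => (du t - k * (P t / extendLeft m t ^ 2),
      -(1 + lam) * m t ^ 2 * u t - k * (-(1 + lam) * extendLeft m t ^ 2 * U t)))
    (K := 1 / c + |1 + lam| * d) (a := 0) (b := a)
    ((h.memH2.cont.sub (continuousOn_const.mul hs.continuous_u.continuousOn)).prodMk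
      (hpc.sub (continuousOn_const.mul hs.continuous_p.continuousOn)))
    (fun t ht => ((hder h.memH2.cont_deriv hu1 t ht).sub
      ((hs.deriv_u t).hasDerivWithinAt.const_mul k)).prodMk
      ((hder hgc hp1 t ht).sub ((hs.deriv_p t).hasDerivWithinAt.const_mul k)))
    (by simp [h.dirichlet, hs.zero, hs.one, hk])
    (by
      intro t ht
      have hmt : extendLeft m t = m t := extendLeft_of_nonneg m ht.1
      obtain ⟨b1, b2⟩ := hb t ⟨by linarith [ht.1], ht.2.le⟩
      rw [hmt] at b1 b2
      have hmp : 0 < m t ^ 2 := pow_pos (hpos t ht.1) 2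
      rw [hmt]
      set N := ‖(u t - k * U t, m t ^ 2 * du t - k * P t)‖ with hN
      have n1 : |u t - k * U t| ≤ N := norm_fst_le (u t - k * U t, m t ^ 2 * du t - k * P t)
      have n2 : |m t ^ 2 * du t - k * P t| ≤ N :=
        norm_snd_le (u t - k * U t, m t ^ 2 * du t - k * P t)
      have hN0 : 0 ≤ N := norm_nonneg _
      refine norm_prod_le_iff.2 ⟨?_, ?_⟩
      · have e : du t - k * (P t / m t ^ 2) = 1 / m t ^ 2 * (m t ^ 2 * du t - k * P t) := by
          have := (hpos t ht.1).ne'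
          field_simp
        calc ‖du t - k * (P t / m t ^ 2)‖ = 1 / m t ^ 2 * |m t ^ 2 * du t - k * P t| := by
              rw [e, Real.norm_eq_abs, abs_mul, abs_of_pos (one_div_pos.2 hmp)]
          _ ≤ 1 / c * N := by gcongr
          _ ≤ (1 / c + |1 + lam| * d) * N := by
              gcongr
              exact le_add_of_nonneg_right (by positivity)
      · have e : -(1 + lam) * m t ^ 2 * u t - k * (-(1 + lam) * m t ^ 2 * U t) =
            -((1 + lam) * m t ^ 2 * (u t - k * U t)) := by ring
        calc ‖-(1 + lam) * m t ^ 2 * u t - k * (-(1 + lam) * m t ^ 2 * U t)‖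
            = |1 + lam| * m t ^ 2 * |u t - k * U t| := by
              rw [e, norm_neg, Real.norm_eq_abs, abs_mul, abs_mul, abs_of_pos hmp]
          _ ≤ |1 + lam| * d * N := by gcongr
          _ ≤ (1 / c + |1 + lam| * d) * N := by
              gcongr
              exact le_add_of_nonneg_left (by positivity))
  have heq : ∀ t ∈ Icc 0 a, u t = k * U t ∧ du t = k * (P t / m t ^ 2) := by
    intro t ht
    have := hzero t ht
    have hmp := (hpos t ht.1).ne'
    simp only [Prod.mk_eq_zero] at this
    refine ⟨by linarith [this.1], ?_⟩
    field_simp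
    linarith [this.2]
  refine ⟨k, fun hk0 => ?_, heq⟩
  obtain ⟨s, hs1, hs2⟩ := h.ne_zero
  exact hs2 (by rw [(heq s (Ioo_subset_Icc_self hs1)).1, hk0, zero_mul])

end Classical

/-! ### The lowest Dirichlet-Robin eigenvalue and the number `a*` -/

section Eigenvalues

variable {m : ℝ → ℝ}

theorem IsSolution.isDirichletSolution (hm : ContDiffOn ℝ 1 m (Ici 0))
    (hpos : ∀ t, 0 ≤ t → 0 < m t) {a lam : ℝ} (ha : 0 < a) {U P : ℝ → ℝ}
    (hs : IsSolution (extendLeft m) (1 + lam) U P) :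
    IsDirichletSolution m a lam U fun t => P t / extendLeft m t ^ 2 := by
  have hM := continuous_extendLeft hm.continuousOn
  have hMpos := extendLeft_pos hpos
  have hM2 : ∀ t, extendLeft m t ^ 2 ≠ 0 := fun t => (pow_pos (hMpos t) 2).ne'
  have hdu : Continuous fun t => P t / extendLeft m t ^ 2 := hs.continuous_p.div (hM.pow 2) hM2
  have hm' : ContinuousOn (derivWithin m (Ici 0)) (Ici 0) :=
    hm.continuousOn_derivWithin (uniqueDiffOn_Ici 0) le_rfl
  have hMd : ∀ t, 0 < t → HasDerivAt (extendLeft m) (derivWithin m (Ici 0) t) t := by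
    intro t ht
    have h1 : HasDerivAt m (derivWithin m (Ici 0) t) t :=
      ((hm.differentiableOn (by norm_num) t ht.le).hasDerivWithinAt).hasDerivAt (Ici_mem_nhds ht)
    refine h1.congr_of_eventuallyEq ?_
    filter_upwards [Ioi_mem_nhds ht] with s hs
    exact extendLeft_of_nonneg m (le_of_lt hs)
  refine ⟨⟨hs.continuous_u.continuousOn, hdu.continuousOn, ?_, ?_⟩, hs.zero, ?_, ?_⟩
  · exact hasWeakDeriv_of_hasDerivAt ha.le hs.continuous_u.continuousOn hdu.continuousOn
      fun t _ => hs.deriv_u t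
  · set ddu : ℝ → ℝ := fun t => (-(1 + lam) * extendLeft m t ^ 2 * U t * extendLeft m t ^ 2 -
      P t * (2 * extendLeft m t * derivWithin m (Ici 0) t)) / (extendLeft m t ^ 2) ^ 2 with hddu
    have hc : ContinuousOn ddu (Icc 0 a) := by
      have hm'' := hm'.mono fun t (ht : t ∈ Icc 0 a) => ht.1
      have := hs.continuous_u
      have := hs.continuous_p
      exact ContinuousOn.div (by fun_prop) (by fun_prop) fun t _ => pow_ne_zero 2 (hM2 t)
    refine ⟨ddu, ?_, ?_⟩
    · obtain ⟨C, hC⟩ := isCompact_Icc.exists_bound_of_continuousOn hc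
      refine MemLp.of_bound
        ((hc.mono Ioo_subset_Icc_self).aestronglyMeasurable measurableSet_Ioo) C ?_
      filter_upwards [ae_restrict_mem measurableSet_Ioo] with t ht
      exact hC t (Ioo_subset_Icc_self ht)
    · refine hasWeakDeriv_of_hasDerivAt ha.le hdu.continuousOn hc fun t ht => ?_
      refine ((hs.deriv_p t).div ((hMd t ht.1).pow 2) (hM2 t)).congr_deriv ?_
      simp [hddu]
  · refine ⟨fun t => -(1 + lam) * extendLeft m t ^ 2 * U t, ?_, ?_⟩
    · have hw := hasWeakDeriv_of_hasDerivAt ha.le hs.continuous_p.continuousOn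
        (g := fun t => -(1 + lam) * extendLeft m t ^ 2 * U t)
        (by have := hs.continuous_u; fun_prop) fun t _ => hs.deriv_p t
      intro φ h1 h2 h3
      rw [← hw φ h1 h2 h3]
      refine setIntegral_congr_fun measurableSet_Ioo fun t ht => ?_
      have := (hpos t ht.1.le).ne'
      simp only [extendLeft_of_nonneg m ht.1.le]
      field_simp
    · filter_upwards [ae_restrict_mem measurableSet_Ioo] with t ht
      have := (hpos t ht.1.le).ne'
      simp only [extendLeft_of_nonneg m ht.1.le]
      field_simp
      ring
  · obtain ⟨t, hvt, ht⟩ := ((hs.eventually_pos hMpos).and (Ioo_mem_nhdsGT ha)).exists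
    exact ⟨t, ht, hvt.ne'⟩

/-- The eigenvalue condition by shooting: `lam` is an eigenvalue if and only if the normalized
solution satisfies the Robin condition at `a`. -/
theorem exists_isDREigenfunction_iff (hm : ContDiffOn ℝ 1 m (Ici 0))
    (hpos : ∀ t, 0 ≤ t → 0 < m t) {a lam : ℝ} (ha : 0 < a) {U P : ℝ → ℝ}
    (hs : IsSolution (extendLeft m) (1 + lam) U P) :
    (∃ u du, IsDREigenfunction m a lam u du) ↔ P a = extendLeft m a ^ 2 * U a := by
  have hM2 := pow_pos (extendLeft_pos hpos a) 2
  constructor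
  · rintro ⟨u, du, h, hr⟩
    obtain ⟨k, hk, he⟩ := h.eq_smul hm.continuousOn hpos ha hs
    obtain ⟨e1, e2⟩ := he a (right_mem_Icc.2 ha.le)
    rw [e1, e2, ← extendLeft_of_nonneg m ha.le] at hr
    have := mul_left_cancel₀ hk hr
    rw [div_eq_iff hM2.ne'] at this
    rw [this, mul_comm]
  · intro h
    exact ⟨U, _, hs.isDirichletSolution hm hpos ha, by rw [h]; exact mul_div_cancel_left₀ _ hM2.ne'⟩

/-- The eigenvalues are the zeros of a continuous function `D`. It is positive at `0` and negative
at some point, so the set of eigenvalues is nonempty and closed and does not contain `0`; Picone's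
identity bounds it below by `0`. -/
theorem lambdaDR_pos (hm : ContDiffOn ℝ 1 m (Ici 0)) (hpos : ∀ t, 0 ≤ t → 0 < m t)
    {U P : ℝ → ℝ} (hs : IsSolution (extendLeft m) 1 U P) {a : ℝ} (ha : 0 < a)
    (hlt : ∀ t, 0 < t → t ≤ a → extendLeft m t ^ 2 * U t < P t) : 0 < lambdaDR m a := by
  have hM := continuous_extendLeft hm.continuousOn
  have hMpos := extendLeft_pos hpos
  have hM2 := fun t => pow_pos (hMpos t) 2
  choose θ h0 hθ using exists_pruefer hM hMpos
  have hsol := fun μ => isSolution_of_pruefer hM hMpos (h0 μ) (hθ μ)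
  have hcont := continuous_pruefer_param hM hMpos h0 hθ ha.le
  set D : ℝ → ℝ := fun lam => Real.cos (θ (1 + lam) a) -
    extendLeft m a ^ 2 * Real.sin (θ (1 + lam) a) with hD
  have hDc : Continuous D := by
    have : Continuous fun lam => θ (1 + lam) a := hcont.comp (by fun_prop)
    fun_prop
  have hset : {lam : ℝ | ∃ u du, IsDREigenfunction m a lam u du} = {lam | D lam = 0} := by
    ext lam
    have hρ := prueferRadius_pos (M := extendLeft m) (1 + lam) (θ (1 + lam)) a
    rw [mem_ofPred_eq, exists_isDREigenfunction_iff hm hpos ha (hsol (1 + lam)), mem_ofPred_eq]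
    simp only [hD, sub_eq_zero]
    rw [mul_left_comm, mul_right_inj' hρ.ne']
  have hU : ∀ t, 0 < t → t ≤ a → 0 < U t := fun t ht hta =>
    hs.pos_of_lt hMpos (fun s h1 h2 => hlt s h1 h2.le) ht hta
  -- the solution built from `θ 1` agrees with `U`, `P`
  have heq : ∀ t, 0 < t → t ≤ a → 0 < Real.cos (θ 1 t) ∧
      extendLeft m t ^ 2 * Real.sin (θ 1 t) < Real.cos (θ 1 t) := by
    intro t ht hta
    have hs0 : IsSolution (extendLeft m) (1 + 0) U P := by rwa [add_zero]
    obtain ⟨k, hk, he⟩ := ((hsol (1 + 0)).isDirichletSolution hm hpos ht).eq_smul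
      hm.continuousOn hpos ht hs0
    have hρ := prueferRadius_pos (M := extendLeft m) (1 + 0) (θ (1 + 0)) t
    have hk1 : k = 1 := by
      have := (he 0 (left_mem_Icc.2 ht.le)).2
      rw [(hsol (1 + 0)).one, hs.one, ← extendLeft_of_nonneg m le_rfl] at this
      have h2 := (hM2 0).ne'
      exact mul_right_cancel₀ (one_div_ne_zero h2) (this.symm.trans (one_mul _).symm)
    obtain ⟨e1, e2⟩ := he t (right_mem_Icc.2 ht.le)
    rw [hk1, one_mul] at e1 e2
    rw [← extendLeft_of_nonneg m ht.le, div_left_inj' (hM2 t).ne'] at e2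
    simp only [add_zero] at e1 e2 hρ
    have hlt' := hlt t ht hta
    have hP : 0 < P t := (mul_pos (hM2 t) (hU t ht hta)).trans hlt'
    rw [← e2] at hP
    rw [← e1, ← e2, mul_left_comm] at hlt'
    exact ⟨(mul_pos_iff_of_pos_left hρ).1 hP, lt_of_mul_lt_mul_left hlt' hρ.le⟩
  -- `D 0 > 0` determines `θ 1 a` only modulo `2 π`; that it is below `π / 2` needs the whole
  -- interval
  have hθ1 : θ 1 a < Real.pi / 2 := by
    by_contra! h
    have hc : ContinuousOn (θ 1) (Icc 0 a) :=
      fun t _ => (hθ 1 t).continuousAt.continuousWithinAt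
    obtain ⟨s, hs1, hs2⟩ := intermediate_value_Icc ha.le hc
      (show Real.pi / 2 ∈ Icc (θ 1 0) (θ 1 a) from ⟨by rw [h0]; positivity, h⟩)
    rcases hs1.1.eq_or_lt with h' | h'
    · rw [← h', h0] at hs2
      linarith [Real.pi_pos]
    · have := (heq s h' hs1.2).1
      rw [hs2, Real.cos_pi_div_two] at this
      exact lt_irrefl _ this
  have hD0 : 0 < D 0 := by
    have := (heq a ha le_rfl).2
    simp only [hD, add_zero]
    linarith
  -- for some parameter the angle at `a` is `π / 2`, and there `D` is negative
  obtain ⟨μ₁, hμ₁⟩ := exists_pruefer_ge hM hMpos h0 hθ ha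
  obtain ⟨μ₂, hμ₂⟩ := mem_range_of_exists_le_of_exists_ge hcont ⟨1, hθ1.le⟩ ⟨μ₁, hμ₁⟩
  have hDneg : D (μ₂ - 1) < 0 := by
    simp only [hD, add_sub_cancel, hμ₂, Real.cos_pi_div_two, Real.sin_pi_div_two]
    linarith [hM2 a]
  obtain ⟨lam₀, hlam₀⟩ := mem_range_of_exists_le_of_exists_ge hDc ⟨_, hDneg.le⟩ ⟨0, hD0.le⟩
  have hnonneg : ∀ lam ∈ {lam | D lam = 0}, 0 ≤ lam := by
    intro lam hlam
    rw [← hset, mem_ofPred_eq, exists_isDREigenfunction_iff hm hpos ha (hsol (1 + lam))] at hlam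
    have := hs.one_le_of_robin hMpos (hsol (1 + lam)) ha hU (hlt a ha le_rfl).le hlam
    linarith
  rw [lambdaDR, hset]
  have hmem : sInf {lam | D lam = 0} ∈ {lam | D lam = 0} :=
    (isClosed_eq hDc continuous_const).csInf_mem ⟨lam₀, hlam₀⟩ ⟨0, hnonneg⟩
  refine lt_of_le_of_ne (hnonneg _ hmem) fun h => ?_
  rw [← h] at hmem
  exact hD0.ne' hmem

theorem lambdaDR_eq_zero (hm : ContDiffOn ℝ 1 m (Ici 0)) (hpos : ∀ t, 0 ≤ t → 0 < m t)
    {U P : ℝ → ℝ} (hs : IsSolution (extendLeft m) 1 U P) {a : ℝ} (ha : 0 < a)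
    (hlt : ∀ t, 0 < t → t < a → extendLeft m t ^ 2 * U t < P t)
    (heq : P a = extendLeft m a ^ 2 * U a) : lambdaDR m a = 0 := by
  have hM := continuous_extendLeft hm.continuousOn
  have hMpos := extendLeft_pos hpos
  have hs0 : IsSolution (extendLeft m) (1 + 0) U P := by rwa [add_zero]
  refine IsLeast.csInf_eq ⟨(exists_isDREigenfunction_iff hm hpos ha hs0).2 heq, ?_⟩
  intro lam hlam
  obtain ⟨θ, h0, hθ⟩ := exists_pruefer hM hMpos (1 + lam)
  have hv := isSolution_of_pruefer hM hMpos h0 hθ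
  have := hs.one_le_of_robin hMpos hv ha (fun t => hs.pos_of_lt hMpos hlt) heq.ge
    ((exists_isDREigenfunction_iff hm hpos ha hv).1 hlam)
  linarith

/-- `a*` is the first positive zero of `u' - u`, and `∞` if there is none, where `u` is the solution
of `K_m u = 0` with `u(0) = 0` and positive initial slope. -/
theorem aStar_cases (hm : ContDiffOn ℝ 1 m (Ici 0)) (hpos : ∀ t, 0 ≤ t → 0 < m t)
    {U P : ℝ → ℝ} (hs : IsSolution (extendLeft m) 1 U P) :
    (aStar m = ⊤ ∧ ∀ t, 0 < t → extendLeft m t ^ 2 * U t < P t) ∨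
    ∃ c : ℝ, 0 < c ∧ aStar m = (c : EReal) ∧
      (∀ t, 0 < t → t < c → extendLeft m t ^ 2 * U t < P t) ∧
      P c = extendLeft m c ^ 2 * U c := by
  have hM := continuous_extendLeft hm.continuousOn
  have hMpos := extendLeft_pos hpos
  have hcP := hs.continuous_p
  have hcU := hs.continuous_u
  have hcMU : Continuous fun t => extendLeft m t ^ 2 * U t := by fun_prop
  set N : Set ℝ := Ici 0 ∩ {t | P t ≤ extendLeft m t ^ 2 * U t} with hN
  have hNc : IsClosed N := isClosed_Ici.inter (isClosed_le hcP hcMU)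
  have hN0 : (0 : ℝ) ∉ N := by
    simp [hN, hs.zero, hs.one]
  rcases N.eq_empty_or_nonempty with hE | hE
  · left
    have hlt : ∀ t, 0 < t → extendLeft m t ^ 2 * U t < P t := by
      intro t ht
      by_contra! h
      exact notMem_empty t (hE ▸ ⟨ht.le, h⟩)
    refine ⟨?_, hlt⟩
    rw [aStar, EReal.eq_top_iff_forall_lt]
    intro y
    refine (EReal.coe_lt_coe_iff.2 (lt_of_le_of_lt (le_abs_self y) (lt_add_one |y|))).trans_le ?_
    refine le_sSup ⟨|y| + 1, rfl, by positivity, fun a ha _ => ?_⟩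
    exact lambdaDR_pos hm hpos hs ha fun t ht _ => hlt t ht
  · right
    have hbdd : BddBelow N := ⟨0, fun t ht => ht.1⟩
    have hcN : sInf N ∈ N := hNc.csInf_mem hE hbdd
    set c := sInf N with hc
    have hc0 : 0 < c := lt_of_le_of_ne hcN.1 fun h => hN0 (h ▸ hcN)
    have hlt : ∀ t, 0 < t → t < c → extendLeft m t ^ 2 * U t < P t := by
      intro t ht htc
      by_contra! h
      exact absurd (csInf_le hbdd ⟨ht.le, h⟩) (not_le.2 htc)
    have heq : P c = extendLeft m c ^ 2 * U c := by
      refine le_antisymm hcN.2 ?_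
      have l1 := (hcMU.tendsto c).mono_left (nhdsWithin_le_nhds (s := Iio c))
      have l2 := (hcP.tendsto c).mono_left (nhdsWithin_le_nhds (s := Iio c))
      refine le_of_tendsto_of_tendsto l1 l2 ?_
      filter_upwards [Ioo_mem_nhdsLT hc0] with t ht
      exact (hlt t ht.1 ht.2).le
    refine ⟨c, hc0, le_antisymm ?_ ?_, hlt, heq⟩
    · refine sSup_le ?_
      rintro _ ⟨c', rfl, -, h⟩
      by_contra! hcc
      have := h c hc0 (EReal.coe_lt_coe_iff.1 hcc)
      rw [lambdaDR_eq_zero hm hpos hs hc0 hlt heq] at this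
      exact lt_irrefl _ this
    · refine le_sSup ⟨c, rfl, hc0, fun a ha hac => ?_⟩
      exact lambdaDR_pos hm hpos hs ha fun t ht hta => hlt t ht (hta.trans_lt hac)

end Eigenvalues

/-! ### The optimal weight -/

section Weight
open scoped NNReal

theorem lipschitzWith_of_hasDerivAt_off_finite {f f' : ℝ → ℝ} {C : ℝ≥0} {s : Set ℝ}
    (hs : s.Finite) (hf : Continuous f) (hd : ∀ t ∉ s, HasDerivAt f (f' t) t)
    (hb : ∀ t ∉ s, |f' t| ≤ C) : LipschitzWith C f := by
  have hae : ∀ᵐ t : ℝ, t ∉ s := hs.countable.ae_notMem volume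
  have hbd : ∀ t ∉ s, ‖deriv f t‖ ≤ C := fun t ht => by
    rw [(hd t ht).deriv]; exact hb t ht
  refine LipschitzWith.of_dist_le_mul fun x y => ?_
  have hint : IntervalIntegrable (deriv f) volume y x := by
    refine intervalIntegrable_iff.2 (Measure.integrableOn_of_bounded (M := C)
      (by simp [uIoc]) (measurable_deriv f).aestronglyMeasurable ?_)
    exact ae_restrict_of_ae (hae.mono hbd)
  have key := integral_eq_of_hasDerivAt_off_countable f (deriv f) (a := y) (b := x) hs.countable
    hf.continuousOn (fun t ht => by rw [(hd t ht.2).deriv]; exact hd t ht.2) hint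
  rw [Real.dist_eq, Real.dist_eq, ← key]
  exact intervalIntegral.norm_integral_le_of_norm_le_const_ae (hae.mono fun t ht _ => hbd t ht)

/-- The weight `Φ` of the energy inequality. It is `u / u(a)` on `[0, a]`, grows like `e^s` on
`[a, T - b]`, is a multiple of `p(T - s)` on `[T - b, T]`, and decays like `e^{-s}` after `T`. So
`Φ² - Φ'²` vanishes outside of `[0, a]` and `[T - b, T]`; on these the pieces are the optimal
competitors, for integration against `M²` and `M(T - s)⁻²` respectively. -/
def weight (u p : ℝ → ℝ) (a b T s : ℝ) : ℝ :=
  if s ≤ 0 then 0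
  else if s ≤ a then u s / u a
  else if s ≤ T - b then Real.exp (s - a)
  else if s ≤ T then Real.exp (T - a - b) * (p (T - s) / p b)
  else Real.exp (T - a - b) * (p 0 / p b) * Real.exp (-(s - T))

/-- The derivative of `weight` away from `0`, `a`, `T - b` and `T`. -/
def weightDeriv (M u p : ℝ → ℝ) (a b T s : ℝ) : ℝ :=
  if s ≤ 0 then 0
  else if s ≤ a then p s / M s ^ 2 / u a
  else if s ≤ T - b then Real.exp (s - a)
  else if s ≤ T then Real.exp (T - a - b) * (M (T - s) ^ 2 * u (T - s) / p b)
  else -(Real.exp (T - a - b) * (p 0 / p b) * Real.exp (-(s - T)))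

variable {M u p : ℝ → ℝ}

theorem continuous_weight (h : IsSolution M 1 u p) {a b T : ℝ} (ha : 0 < a) (hb : 0 < b)
    (hT : a + b < T) (hua : u a ≠ 0) (hpb : p b ≠ 0) : Continuous (weight u p a b T) := by
  have hu := h.continuous_u
  have hp := h.continuous_p
  unfold weight
  refine Continuous.if_le continuous_const (Continuous.if_le (by fun_prop) (Continuous.if_le
    (by fun_prop) (Continuous.if_le (by fun_prop) (by fun_prop) (by fun_prop) (by fun_prop) ?_)
    (by fun_prop) (by fun_prop) ?_) (by fun_prop) (by fun_prop) ?_) (by fun_prop) (by fun_prop) ?_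
  · rintro s rfl
    simp
  · rintro s rfl
    rw [if_pos (by linarith), sub_sub_cancel, div_self hpb, mul_one]
    congr 1
    ring
  · rintro s rfl
    rw [if_pos (by linarith), div_self hua, sub_self, Real.exp_zero]
  · rintro s rfl
    rw [if_pos ha.le, h.zero, zero_div]

theorem hasDerivAt_weight (h : IsSolution M 1 u p) {a b T : ℝ} {s : ℝ}
    (hs : s ∉ ({0, a, T - b, T} : Set ℝ)) :
    HasDerivAt (weight u p a b T) (weightDeriv M u p a b T s) s := by
  simp only [mem_insert_iff, mem_singleton_iff, not_or] at hs
  obtain ⟨h0, h1, h2, h3⟩ := hs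
  have hlt : ∀ {c : ℝ}, s ≤ c → s ≠ c → ∀ᶠ r in 𝓝 s, r ≤ c := fun hc hne =>
    eventually_of_mem (Iio_mem_nhds (lt_of_le_of_ne hc hne)) fun r hr => le_of_lt hr
  have hgt : ∀ {c : ℝ}, ¬ s ≤ c → ∀ᶠ r in 𝓝 s, ¬ r ≤ c := fun hc =>
    eventually_of_mem (Ioi_mem_nhds (not_le.1 hc)) fun r hr => not_le.2 hr
  unfold weightDeriv
  split_ifs with c0 c1 c2 c3
  · refine (hasDerivAt_const s (0 : ℝ)).congr_of_eventuallyEq ?_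
    filter_upwards [hlt c0 h0] with r hr
    rw [weight, if_pos hr]
  · refine ((h.deriv_u s).div_const (u a)).congr_of_eventuallyEq ?_
    filter_upwards [hgt c0, hlt c1 h1] with r r0 r1
    rw [weight, if_neg r0, if_pos r1]
  · have hd := ((hasDerivAt_id s).sub_const a).exp
    rw [mul_one] at hd
    refine hd.congr_of_eventuallyEq ?_
    filter_upwards [hgt c0, hgt c1, hlt c2 h2] with r r0 r1 r2
    rw [weight, if_neg r0, if_neg r1, if_pos r2]
    rfl
  · have hd := ((((h.deriv_p (T - s)).comp s ((hasDerivAt_id s).const_sub T)).div_const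
      (p b)).const_mul (Real.exp (T - a - b)))
    refine (hd.congr_deriv (by ring)).congr_of_eventuallyEq ?_
    filter_upwards [hgt c0, hgt c1, hgt c2, hlt c3 h3] with r r0 r1 r2 r3
    rw [weight, if_neg r0, if_neg r1, if_neg r2, if_pos r3]
    rfl
  · have hd := (((hasDerivAt_id s).sub_const T).neg.exp).const_mul
      (Real.exp (T - a - b) * (p 0 / p b))
    refine (hd.congr_deriv (by simp)).congr_of_eventuallyEq ?_
    filter_upwards [hgt c0, hgt c1, hgt c2, hgt c3] with r r0 r1 r2 r3
    rw [weight, if_neg r0, if_neg r1, if_neg r2, if_neg r3]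
    rfl

theorem exists_weight_bound (hM : Continuous M) (hpos : ∀ t, 0 < M t) (h : IsSolution M 1 u p)
    {a b T : ℝ} (ha : 0 < a) (hb : 0 < b) (hT : a + b < T)
    (hua : ∀ t, 0 < t → t ≤ a → 0 < u t)
    (hub : ∀ t, 0 < t → t ≤ b → 0 < u t ∧ M t ^ 2 * u t ≤ p t) :
    ∃ C : ℝ≥0, (∀ s, |weight u p a b T s| ≤ C) ∧ LipschitzWith C (weight u p a b T) := by
  have hu := h.continuous_u
  have hp := h.continuous_p
  have hpb : 0 < p b := (mul_pos (pow_pos (hpos b) 2) (hub b hb le_rfl).1).trans_le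
    (hub b hb le_rfl).2
  have hc := continuous_weight h ha hb hT (hua a ha le_rfl).ne' hpb.ne'
  have hM2 : ∀ s, M s ^ 2 ≠ 0 := fun s => (pow_pos (hpos s) 2).ne'
  obtain ⟨C₁, hC₁⟩ := isCompact_Icc.exists_bound_of_continuousOn (s := Icc 0 T) hc.continuousOn
  have hdc : Continuous fun s => p s / M s ^ 2 / u a := (hp.div (hM.pow 2) hM2).div_const _
  obtain ⟨C₂, hC₂⟩ := isCompact_Icc.exists_bound_of_continuousOn (s := Icc 0 a) hdc.continuousOn
  have hT0 : 0 ≤ T := by linarith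
  have hC₁0 : 0 ≤ C₁ := (norm_nonneg _).trans (hC₁ 0 ⟨le_rfl, hT0⟩)
  have hbd : ∀ s, |weight u p a b T s| ≤ C₁ := by
    intro s
    rcases le_or_gt s 0 with h0 | h0
    · rw [weight, if_pos h0, abs_zero]; exact hC₁0
    rcases le_or_gt s T with h1 | h1
    · exact hC₁ s ⟨h0.le, h1⟩
    · have e := hC₁ T ⟨hT0, le_rfl⟩
      rw [weight, if_neg (by linarith), if_neg (by linarith), if_neg (by linarith),
        if_pos le_rfl, sub_self, Real.norm_eq_abs] at e
      rw [weight, if_neg (by linarith), if_neg (by linarith), if_neg (by linarith),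
        if_neg (by linarith), abs_mul, abs_of_pos (Real.exp_pos (-(s - T)))]
      refine le_trans (mul_le_of_le_one_right (abs_nonneg _) ?_) e
      exact Real.exp_le_one_iff.2 (by linarith)
  have hdb : ∀ s ∉ ({0, a, T - b, T} : Set ℝ), |weightDeriv M u p a b T s| ≤ max C₁ C₂ := by
    intro s hs
    simp only [mem_insert_iff, mem_singleton_iff, not_or] at hs
    have hw := (hbd s).trans (le_max_left C₁ C₂)
    unfold weightDeriv
    unfold weight at hw
    split_ifs at hw ⊢ with c0 c1 c2 c3
    · exact hw
    · exact (hC₂ s ⟨(not_le.1 c0).le, c1⟩).trans (le_max_right _ _)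
    · exact hw
    · refine le_trans ?_ hw
      have hpos1 : 0 < T - s := sub_pos.2 (lt_of_le_of_ne c3 hs.2.2.2)
      obtain ⟨q1, q2⟩ := hub (T - s) hpos1 (by linarith [not_le.1 c2])
      have hm := pow_pos (hpos (T - s)) 2
      refine abs_le_abs_of_nonneg (by positivity) ?_
      gcongr
    · rwa [abs_neg]
  refine ⟨⟨max C₁ C₂, hC₁0.trans (le_max_left _ _)⟩,
    fun s => (hbd s).trans (le_max_left _ _), ?_⟩
  exact lipschitzWith_of_hasDerivAt_off_finite (s := {0, a, T - b, T}) (by simp) hc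
    (fun t ht => hasDerivAt_weight h ht) hdb

/-- The energy of the solution is a boundary term. The integrand comes up on both sides of the
estimate: on `[0, a]` as `(u'² - u²) M²`, and on `[T - b, T]`, reflected, as `(p² - p'²) / M²`. -/
theorem integral_lagrangian (hM : Continuous M) (hpos : ∀ t, 0 < M t) (h : IsSolution M 1 u p)
    (a : ℝ) : ∫ s in (0 : ℝ)..a, (p s ^ 2 / M s ^ 2 - M s ^ 2 * u s ^ 2) = u a * p a := by
  have hu := h.continuous_u
  have hp := h.continuous_p
  have hM2 : ∀ s, M s ^ 2 ≠ 0 := fun s => (pow_pos (hpos s) 2).ne'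
  have hc : Continuous fun s => p s ^ 2 / M s ^ 2 - M s ^ 2 * u s ^ 2 :=
    ((hp.pow 2).div (hM.pow 2) hM2).sub (by fun_prop)
  rw [intervalIntegral.integral_eq_sub_of_hasDerivAt (f := fun s => u s * p s)
    (fun s _ => ((h.deriv_u s).mul (h.deriv_p s)).congr_deriv (by ring))
    (hc.intervalIntegrable _ _), h.zero, zero_mul, sub_zero]

end Weight

section Estimate

variable {H : Type*} [NormedAddCommGroup H] [InnerProductSpace ℂ H] [CompleteSpace H]
  {S : ℝ → H →L[ℂ] H} {M u p : ℝ → ℝ}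

/-- The semigroup estimate with an additional factor `e^{ω' T}`, for `ω'` above the growth rate. -/
theorem norm_le_of_growth (hS : IsC0Semigroup S) (hM : Continuous M) (hpos : ∀ t, 0 < M t)
    (hSM : ∀ t, 0 ≤ t → ‖S t‖ ≤ M t) (h : IsSolution M 1 u p) {N ω ω' : ℝ}
    (hN : ∀ t, 0 ≤ t → ‖S t‖ ≤ N * Real.exp (ω * t)) (hω : ω < ω') (hω' : 0 ≤ ω')
    (hR : ∀ z : ℂ, z.re = ω' → ∃ R, IsResolventAt (generator S) z R ∧ ‖R‖ ≤ 1)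
    {a b T : ℝ} (ha : 0 < a) (hb : 0 < b) (hT : a + b < T)
    (hua : ∀ t, 0 < t → t ≤ a → 0 < u t ∧ M t ^ 2 * u t ≤ p t)
    (hub : ∀ t, 0 < t → t ≤ b → 0 < u t ∧ M t ^ 2 * u t ≤ p t) :
    ‖S T‖ ≤ Real.exp (ω' * T) * (Real.exp (-(T - a - b)) * (√(p a / u a) * √(p b / u b))) := by
  have hu := h.continuous_u
  have hp := h.continuous_p
  have hM2 : ∀ s, 0 < M s ^ 2 := fun s => pow_pos (hpos s) 2
  have hua0 := (hua a ha le_rfl).1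
  have hub0 := (hub b hb le_rfl).1
  have hpa0 : 0 < p a := (mul_pos (hM2 a) hua0).trans_le (hua a ha le_rfl).2
  have hpb0 : 0 < p b := (mul_pos (hM2 b) hub0).trans_le (hub b hb le_rfl).2
  obtain ⟨C, hC, hL⟩ := exists_weight_bound hM hpos h ha hb hT (fun t h1 h2 => (hua t h1 h2).1) hub
  refine ContinuousLinearMap.opNorm_le_bound _ (by positivity) fun x => ?_
  obtain ⟨hFi, hF⟩ := integral_energy_nonpos hS hN hω hR x
    (fun t ht => by rw [weight, if_pos ht]) hC hL
  set Φ := weight u p a b T with hΦ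
  set q : ℝ → ℝ := fun s => p s ^ 2 / M s ^ 2 - M s ^ 2 * u s ^ 2 with hq
  have hqc : Continuous q := ((hp.pow 2).div (hM.pow 2) fun s => (hM2 s).ne').sub (by fun_prop)
  set E := Real.exp (T - a - b) with hE
  set W := Real.exp (-ω' * T) with hW
  set c₁ := ‖x‖ ^ 2 / u a ^ 2 with hc₁
  set c₂ := W ^ 2 * E ^ 2 * ‖S T x‖ ^ 2 / p b ^ 2 with hc₂
  -- `L` is an integrable lower bound for the integrand of the energy inequality
  set L : ℝ → ℝ := fun s => (Ioc (T - b) T).indicator (fun s => c₂ * q (T - s)) s -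
    (Ioc 0 a).indicator (fun s => c₁ * q s) s with hLdef
  have iq1 : IntegrableOn (fun s => c₁ * q s) (Ioc 0 a) :=
    (Continuous.integrableOn_Icc (by fun_prop)).mono_set Ioc_subset_Icc_self
  have iq2 : IntegrableOn (fun s => c₂ * q (T - s)) (Ioc (T - b) T) :=
    (Continuous.integrableOn_Icc (by fun_prop)).mono_set Ioc_subset_Icc_self
  have i1 := (integrable_indicator_iff measurableSet_Ioc).2 iq1
  have i2 := (integrable_indicator_iff measurableSet_Ioc).2 iq2
  have sub1 : Ioc 0 a ⊆ Ioi 0 := fun s hs => hs.1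
  have sub2 : Ioc (T - b) T ⊆ Ioi 0 := fun s hs =>
    lt_of_le_of_lt (by linarith : (0 : ℝ) ≤ T - b) hs.1
  have hLi : ∫ s in Ioi 0, L s = c₂ * (u b * p b) - c₁ * (u a * p a) := by
    rw [hLdef, integral_sub i2.integrableOn i1.integrableOn,
      setIntegral_indicator measurableSet_Ioc, setIntegral_indicator measurableSet_Ioc,
      inter_eq_right.2 sub2, inter_eq_right.2 sub1, integral_const_mul, integral_const_mul,
      ← intervalIntegral.integral_of_le (by linarith), ← intervalIntegral.integral_of_le ha.le,
      integral_lagrangian hM hpos h, intervalIntegral.integral_comp_sub_left, sub_self,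
      sub_sub_cancel, integral_lagrangian hM hpos h]
  have hmono : ∫ s in Ioi 0, L s ≤ 0 := by
    refine le_trans (setIntegral_mono_ae_restrict (i2.sub i1).integrableOn hFi ?_) hF
    have hfin : ∀ᵐ s : ℝ, s ∉ ({0, a, T - b, T} : Set ℝ) :=
      (Set.toFinite ({0, a, T - b, T} : Set ℝ)).countable.ae_notMem volume
    filter_upwards [ae_restrict_mem measurableSet_Ioi, ae_restrict_of_ae hfin] with s hs0 hs
    have hs0' : 0 < s := hs0
    rw [(hasDerivAt_weight h hs).deriv]
    simp only [mem_insert_iff, mem_singleton_iff, not_or] at hs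
    rcases le_or_gt s a with c1 | c1
    · -- before `a` the integrand is nonpositive and `‖S s x‖ ≤ M s ‖x‖`
      rw [hLdef, hΦ]
      simp only
      rw [indicator_of_notMem (fun hm => by linarith [hm.1]),
        indicator_of_mem (show s ∈ Ioc 0 a from ⟨hs0', c1⟩),
        weight, weightDeriv, if_neg hs0'.not_ge, if_neg hs0'.not_ge, if_pos c1, if_pos c1]
      obtain ⟨hus, hps⟩ := hua s hs0' c1
      have hm := hM2 s
      have hD : 0 ≤ (p s / M s ^ 2) ^ 2 - u s ^ 2 := by
        have : u s ≤ p s / M s ^ 2 := by rwa [le_div_iff₀' hm]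
        exact sub_nonneg.2 (pow_le_pow_left₀ hus.le this 2)
      have hw : Real.exp (-ω' * s) ^ 2 ≤ 1 :=
        pow_le_one₀ (Real.exp_pos _).le (Real.exp_le_one_iff.2 (by nlinarith))
      have hn : ‖S s x‖ ^ 2 ≤ M s ^ 2 * ‖x‖ ^ 2 := by
        rw [← mul_pow]
        exact pow_le_pow_left₀ (norm_nonneg _) ((S s).le_of_opNorm_le (hSM s hs0'.le) x) 2
      have hwn : Real.exp (-ω' * s) ^ 2 * ‖S s x‖ ^ 2 ≤ M s ^ 2 * ‖x‖ ^ 2 :=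
        (mul_le_of_le_one_left (by positivity) hw).trans hn
      have key := mul_le_mul_of_nonneg_right hwn
        (div_nonneg hD (sq_nonneg (u a)))
      have e1 : c₁ * q s = M s ^ 2 * ‖x‖ ^ 2 * (((p s / M s ^ 2) ^ 2 - u s ^ 2) / u a ^ 2) := by
        rw [hc₁, hq]
        have := (hpos s).ne'
        field_simp
      have e2 : Real.exp (-ω' * s) ^ 2 * ((u s / u a) ^ 2 - (p s / M s ^ 2 / u a) ^ 2) *
          ‖S s x‖ ^ 2 = -(Real.exp (-ω' * s) ^ 2 * ‖S s x‖ ^ 2 *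
            (((p s / M s ^ 2) ^ 2 - u s ^ 2) / u a ^ 2)) := by ring
      rw [e1, e2]
      linarith
    rcases le_or_gt s (T - b) with c2 | c2
    · -- between `a` and `T - b` the integrand vanishes
      rw [hLdef, hΦ]
      simp only
      rw [indicator_of_notMem (fun hm => by linarith [hm.1]),
        indicator_of_notMem (fun hm => by linarith [hm.2]),
        weight, weightDeriv, if_neg hs0'.not_ge, if_neg hs0'.not_ge, if_neg c1.not_ge,
        if_neg c1.not_ge, if_pos c2, if_pos c2]
      simp
    rcases le_or_gt s T with c3 | c3
    · -- after `T - b` the integrand is nonnegative and `‖S T x‖ ≤ M (T - s) ‖S s x‖`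
      rw [hLdef, hΦ]
      simp only
      rw [indicator_of_mem (show s ∈ Ioc (T - b) T from ⟨c2, c3⟩),
        indicator_of_notMem (fun hm => by linarith [hm.2]),
        weight, weightDeriv, if_neg hs0'.not_ge, if_neg hs0'.not_ge, if_neg c1.not_ge,
        if_neg c1.not_ge, if_neg c2.not_ge, if_neg c2.not_ge, if_pos c3, if_pos c3]
      have hτ : 0 < T - s := sub_pos.2 (lt_of_le_of_ne c3 hs.2.2.2)
      obtain ⟨hus, hps⟩ := hub (T - s) hτ (by linarith)
      have hm := hM2 (T - s)
      have hD : 0 ≤ p (T - s) ^ 2 - (M (T - s) ^ 2 * u (T - s)) ^ 2 :=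
        sub_nonneg.2 (pow_le_pow_left₀ (by positivity) hps 2)
      have hw : W ^ 2 ≤ Real.exp (-ω' * s) ^ 2 :=
        pow_le_pow_left₀ (Real.exp_pos _).le (Real.exp_le_exp.2 (by nlinarith)) 2
      have hn : ‖S T x‖ ^ 2 ≤ M (T - s) ^ 2 * ‖S s x‖ ^ 2 := by
        rw [← mul_pow]
        have := hS.add (T - s) s hτ.le hs0'.le
        rw [sub_add_cancel] at this
        rw [this]
        exact pow_le_pow_left₀ (norm_nonneg _)
          ((S (T - s)).le_of_opNorm_le (hSM _ hτ.le) (S s x)) 2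
      have hwn := mul_le_mul hw hn (by positivity) (by positivity)
      have key := mul_le_mul_of_nonneg_right hwn (show 0 ≤ E ^ 2 *
        ((p (T - s) ^ 2 - (M (T - s) ^ 2 * u (T - s)) ^ 2) / M (T - s) ^ 2 / p b ^ 2) by positivity)
      have e1 : c₂ * q (T - s) = W ^ 2 * ‖S T x‖ ^ 2 * (E ^ 2 *
          ((p (T - s) ^ 2 - (M (T - s) ^ 2 * u (T - s)) ^ 2) / M (T - s) ^ 2 / p b ^ 2)) := by
        rw [hc₂, hq]
        have := (hpos (T - s)).ne'
        field_simp
      have e2 : Real.exp (-ω' * s) ^ 2 * ((E * (p (T - s) / p b)) ^ 2 -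
          (E * (M (T - s) ^ 2 * u (T - s) / p b)) ^ 2) * ‖S s x‖ ^ 2 =
          Real.exp (-ω' * s) ^ 2 * (M (T - s) ^ 2 * ‖S s x‖ ^ 2) * (E ^ 2 *
          ((p (T - s) ^ 2 - (M (T - s) ^ 2 * u (T - s)) ^ 2) / M (T - s) ^ 2 / p b ^ 2)) := by
        have := (hpos (T - s)).ne'
        field_simp
      rw [e1, e2, sub_zero]
      exact key
    · -- after `T` the integrand vanishes
      rw [hLdef, hΦ]
      simp only
      rw [indicator_of_notMem (fun hm => by linarith [hm.2]),
        indicator_of_notMem (fun hm => by linarith [hm.2]),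
        weight, weightDeriv, if_neg hs0'.not_ge, if_neg hs0'.not_ge, if_neg c1.not_ge,
        if_neg c1.not_ge, if_neg c2.not_ge, if_neg c2.not_ge, if_neg c3.not_ge, if_neg c3.not_ge]
      simp
  rw [hLi] at hmono
  have hW1 : Real.exp (ω' * T) * W = 1 := by
    rw [hW, ← Real.exp_add, neg_mul, add_neg_cancel, Real.exp_zero]
  have hE1 : Real.exp (-(T - a - b)) * E = 1 := by
    rw [hE, ← Real.exp_add, neg_add_cancel, Real.exp_zero]
  have hW0 : 0 < W := Real.exp_pos _
  have hE0 : 0 < E := Real.exp_pos _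
  rw [eq_inv_of_mul_eq_one_left hW1, eq_inv_of_mul_eq_one_left hE1]
  refine (pow_le_pow_iff_left₀ (norm_nonneg _) (by positivity) two_ne_zero).1 ?_
  rw [mul_pow, mul_pow, mul_pow, mul_pow, Real.sq_sqrt (by positivity),
    Real.sq_sqrt (by positivity)]
  have h1 : W ^ 2 * E ^ 2 * ‖S T x‖ ^ 2 * (u b / p b) ≤ ‖x‖ ^ 2 * (p a / u a) := by
    have e1 : c₂ * (u b * p b) = W ^ 2 * E ^ 2 * ‖S T x‖ ^ 2 * (u b / p b) := by
      rw [hc₂]; field_simp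
    have e2 : c₁ * (u a * p a) = ‖x‖ ^ 2 * (p a / u a) := by
      rw [hc₁]; field_simp
    linarith
  have e3 : ‖S T x‖ ^ 2 = W⁻¹ ^ 2 * E⁻¹ ^ 2 * (p b / u b) *
      (W ^ 2 * E ^ 2 * ‖S T x‖ ^ 2 * (u b / p b)) := by field_simp
  rw [e3]
  calc _ ≤ W⁻¹ ^ 2 * E⁻¹ ^ 2 * (p b / u b) * (‖x‖ ^ 2 * (p a / u a)) := by gcongr
    _ = _ := by ring

end Estimate

/-! ### The semigroup estimate without the growth factor -/

section Growth

variable {H : Type*} [NormedAddCommGroup H] [InnerProductSpace ℂ H]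
  {S : ℝ → H →L[ℂ] H} {M u p : ℝ → ℝ}

theorem exists_exponential_bound (hS : IsC0Semigroup S) (hM : Continuous M)
    (hSM : ∀ t, 0 ≤ t → ‖S t‖ ≤ M t) :
    ∃ N ω : ℝ, ∀ t, 0 ≤ t → ‖S t‖ ≤ N * Real.exp (ω * t) := by
  obtain ⟨B₀, hB₀⟩ := isCompact_Icc.exists_bound_of_continuousOn (s := Icc (0 : ℝ) 1)
    hM.continuousOn
  set B := max B₀ 1 with hB
  have hB1 : 1 ≤ B := le_max_right _ _
  have hSB : ∀ t ∈ Icc (0 : ℝ) 1, ‖S t‖ ≤ B := fun t ht =>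
    (hSM t ht.1).trans ((le_abs_self _).trans ((hB₀ t ht).trans (le_max_left _ _)))
  have hn : ∀ n : ℕ, ‖S n‖ ≤ B ^ n := by
    intro n
    induction n with
    | zero =>
      rw [Nat.cast_zero, hS.zero, pow_zero]
      exact ContinuousLinearMap.norm_id_le
    | succ n ih =>
      rw [Nat.cast_succ, hS.add n 1 n.cast_nonneg zero_le_one, pow_succ]
      exact (ContinuousLinearMap.opNorm_comp_le _ _).trans
        (mul_le_mul ih (hSB 1 (by simp)) (norm_nonneg _) (by positivity))
  refine ⟨B, Real.log B, fun t ht => ?_⟩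
  have hfl := Nat.floor_le ht
  have hr : t - ⌊t⌋₊ ∈ Icc (0 : ℝ) 1 :=
    ⟨sub_nonneg.2 hfl, by linarith [Nat.lt_floor_add_one t]⟩
  have e := hS.add (t - ⌊t⌋₊) ⌊t⌋₊ hr.1 (Nat.cast_nonneg _)
  rw [sub_add_cancel] at e
  rw [e]
  refine (ContinuousLinearMap.opNorm_comp_le _ _).trans
    (mul_le_mul (hSB _ hr) ((hn _).trans ?_) (norm_nonneg _) (by positivity))
  rw [← Real.rpow_def_of_pos (by positivity), ← Real.rpow_natCast]
  exact Real.rpow_le_rpow_of_exponent_le hB1 hfl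

/-- The semigroup estimate. `norm_le_of_growth` with `ω' = ω + 1 / 2` improves a growth rate `ω > 0`
to `ω - 1 / 2`; so the growth rate may be taken to be nonpositive, and then `ω'` tends to `0`. -/
theorem norm_le_of_resolvent_le_one [CompleteSpace H] (hS : IsC0Semigroup S) (hM : Continuous M)
    (hpos : ∀ t, 0 < M t) (hSM : ∀ t, 0 ≤ t → ‖S t‖ ≤ M t) (h : IsSolution M 1 u p)
    (hR : ∀ z : ℂ, 0 < z.re → ∃ R, IsResolventAt (generator S) z R ∧ ‖R‖ ≤ 1)
    {a b T : ℝ} (ha : 0 < a) (hb : 0 < b) (hT : a + b < T)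
    (hua : ∀ t, 0 < t → t ≤ a → 0 < u t ∧ M t ^ 2 * u t ≤ p t)
    (hub : ∀ t, 0 < t → t ≤ b → 0 < u t ∧ M t ^ 2 * u t ≤ p t) :
    ‖S T‖ ≤ Real.exp (-(T - a - b)) * (√(p a / u a) * √(p b / u b)) := by
  obtain ⟨N₀, ω₀, h₀⟩ := exists_exponential_bound hS hM hSM
  have hmain : ∀ {N ω ω' : ℝ}, (∀ t, 0 ≤ t → ‖S t‖ ≤ N * Real.exp (ω * t)) → ω < ω' → 0 < ω' →
      ∀ {T}, a + b < T → ‖S T‖ ≤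
        Real.exp (ω' * T) * (Real.exp (-(T - a - b)) * (√(p a / u a) * √(p b / u b))) :=
    fun hN hω hω' _ hT => norm_le_of_growth hS hM hpos hSM h hN hω hω'.le
      (fun z hz => hR z (hz ▸ hω')) ha hb hT hua hub
  -- the estimate lowers a positive exponential rate by `1 / 2`
  have hdescent : ∀ n : ℕ, ∃ N ω : ℝ, (∀ t, 0 ≤ t → ‖S t‖ ≤ N * Real.exp (ω * t)) ∧
      ω ≤ max 0 (ω₀ - n / 2) := by
    intro n
    induction n with
    | zero => exact ⟨N₀, ω₀, h₀, by simp⟩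
    | succ n ih =>
      obtain ⟨N, ω, hN, hle⟩ := ih
      rcases le_or_gt ω 0 with hω | hω
      · exact ⟨N, ω, hN, hω.trans (le_max_left _ _)⟩
      set K := √(p a / u a) * √(p b / u b) with hK
      have hN0 : 0 ≤ N := by simpa using (norm_nonneg _).trans (hN 0 le_rfl)
      refine ⟨N * Real.exp ((a + b) / 2) + Real.exp (a + b) * K, ω - 1 / 2, fun t ht => ?_, ?_⟩
      · rw [add_mul]
        rcases le_or_gt t (a + b) with hab | hab
        · refine le_add_of_le_of_nonneg ((hN t ht).trans ?_) (by positivity)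
          rw [mul_assoc, ← Real.exp_add]
          gcongr
          linarith
        · refine le_add_of_nonneg_of_le (by positivity) ?_
          refine (hmain hN (show ω < ω + 1 / 2 by linarith) (by linarith) hab).trans (le_of_eq ?_)
          rw [← mul_assoc, ← Real.exp_add, mul_right_comm, ← Real.exp_add]
          congr 2
          ring
      · rcases le_max_iff.1 hle with h' | h'
        · exact absurd h' (not_le.2 hω)
        · refine le_trans ?_ (le_max_right _ _)
          push_cast
          linarith
  obtain ⟨n, hn⟩ := exists_nat_ge (2 * ω₀)
  obtain ⟨N, ω, hN, hω⟩ := hdescent n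
  rw [max_eq_left (by linarith)] at hω
  have hlim : Tendsto (fun ω' : ℝ => Real.exp (ω' * T) *
      (Real.exp (-(T - a - b)) * (√(p a / u a) * √(p b / u b)))) (𝓝[>] 0)
      (𝓝 (Real.exp (0 * T) * (Real.exp (-(T - a - b)) * (√(p a / u a) * √(p b / u b))))) :=
    (Continuous.tendsto (by fun_prop) 0).mono_left nhdsWithin_le_nhds
  rw [zero_mul, Real.exp_zero, one_mul] at hlim
  refine ge_of_tendsto hlim ?_
  filter_upwards [self_mem_nhdsWithin] with ω' hω'
  exact hmain hN (hω.trans_lt hω') hω' hT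

theorem exists_resolvent_norm_le_one (hω : omegaOne (generator S) < ((0 : ℝ) : EReal))
    (hr : resolventRate (generator S) 0 = 1) (z : ℂ) (hz : 0 < z.re) :
    ∃ R, IsResolventAt (generator S) z R ∧ ‖R‖ ≤ 1 := by
  obtain ⟨_, ⟨ω, rfl, hρ, hbdd⟩, hω0⟩ := sInf_lt_iff.1 hω
  have hω0' : ω < 0 := EReal.coe_lt_coe_iff.1 hω0
  have hsub : {z : ℂ | 0 < z.re} ⊆ {z : ℂ | ω < z.re} := fun w hw => hω0'.trans hw
  have hex : ∃ R, IsResolventAt (generator S) z R := hρ (hsub hz)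
  refine ⟨resolvent (generator S) z, ?_, ?_⟩
  · rw [resolvent, dif_pos hex]
    exact Classical.choose_spec hex
  · rw [← inv_eq_one.1 hr]
    exact le_csSup (hbdd.mono (image_mono hsub)) (mem_image_of_mem _ hz)

end Growth

/-! ### The first eigenfunction and its logarithmic derivative -/

section FirstEigenfunction

variable {m : ℝ → ℝ}

theorem aStar_pos (hm : ContDiffOn ℝ 1 m (Ici 0)) (hpos : ∀ t, 0 ≤ t → 0 < m t)
    {U P : ℝ → ℝ} (hs : IsSolution (extendLeft m) 1 U P) : 0 < aStar m := by
  rcases aStar_cases hm hpos hs with ⟨h, -⟩ | ⟨c, hc, h, -⟩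
  · rw [h]; exact EReal.zero_lt_top
  · rw [h]; exact EReal.coe_pos.2 hc

theorem pos_of_le_aStar (hm : ContDiffOn ℝ 1 m (Ici 0)) (hpos : ∀ t, 0 ≤ t → 0 < m t)
    {U P : ℝ → ℝ} (hs : IsSolution (extendLeft m) 1 U P) {s : ℝ} (hs0 : 0 < s)
    (hsa : (s : EReal) ≤ aStar m) : 0 < U s ∧ extendLeft m s ^ 2 * U s ≤ P s := by
  have hMpos := extendLeft_pos hpos
  rcases aStar_cases hm hpos hs with ⟨-, h⟩ | ⟨c, -, hc, hlt, heq⟩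
  · exact ⟨hs.pos_of_lt hMpos (fun t ht _ => h t ht) hs0 le_rfl, (h s hs0).le⟩
  · rw [hc, EReal.coe_le_coe_iff] at hsa
    refine ⟨hs.pos_of_lt hMpos hlt hs0 hsa, ?_⟩
    rcases hsa.eq_or_lt with rfl | h
    · exact heq.ge
    · exact (hlt s hs0 h).le

theorem IsSolution.isFirstEigenfunction (hm : ContDiffOn ℝ 1 m (Ici 0))
    (hpos : ∀ t, 0 ≤ t → 0 < m t)
    {U P : ℝ → ℝ} (hs : IsSolution (extendLeft m) 1 U P) :
    IsFirstEigenfunction m U fun t => P t / extendLeft m t ^ 2 := by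
  have hs0 : IsSolution (extendLeft m) (1 + 0) U P := by rwa [add_zero]
  refine ⟨fun c hc => ?_, fun _ c hc => hs0.isDirichletSolution hm hpos hc⟩
  rcases aStar_cases hm hpos hs with ⟨h, -⟩ | ⟨c', hc', h, hlt, heq⟩
  · rw [h] at hc
    exact absurd hc.symm (EReal.coe_ne_top c)
  · rw [h, EReal.coe_eq_coe_iff] at hc
    subst hc
    rw [lambdaDR_eq_zero hm hpos hs hc' hlt heq]
    refine ⟨hs0.isDirichletSolution hm hpos hc', ?_⟩
    have := pow_pos (extendLeft_pos hpos c') 2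
    change P c' / extendLeft m c' ^ 2 = U c'
    rw [heq, mul_div_cancel_left₀ _ this.ne']

/-- Every `u₀` is a nonzero multiple of the normalized solution `U`, also for finite `a*`, since
`λ^{DR}(a*) = 0`; so both have the same logarithmic derivative. -/
theorem IsFirstEigenfunction.logDer_eq (hm : ContDiffOn ℝ 1 m (Ici 0))
    (hpos : ∀ t, 0 ≤ t → 0 < m t) {U P u₀ du₀ : ℝ → ℝ}
    (hs : IsSolution (extendLeft m) 1 U P) (h : IsFirstEigenfunction m u₀ du₀) {s : ℝ}
    (hs0 : 0 < s) (hsa : (s : EReal) ≤ aStar m) :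
    u₀ s ≠ 0 ∧ logDer u₀ du₀ s = P s / m s ^ 2 / U s := by
  have hs1 : IsSolution (extendLeft m) (1 + 0) U P := by rwa [add_zero]
  have hU := (pos_of_le_aStar hm hpos hs hs0 hsa).1.ne'
  obtain ⟨k, hk, e1, e2⟩ : ∃ k, k ≠ 0 ∧ u₀ s = k * U s ∧ du₀ s = k * (P s / m s ^ 2) := by
    rcases aStar_cases hm hpos hs with ⟨ht, -⟩ | ⟨c, hc', hc, hlt, heq⟩
    · obtain ⟨k, hk, he⟩ := (h.2 ht s hs0).eq_smul hm.continuousOn hpos hs0 hs1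
      exact ⟨k, hk, he s (right_mem_Icc.2 hs0.le)⟩
    · have hd := (h.1 c hc).1
      rw [lambdaDR_eq_zero hm hpos hs hc' hlt heq] at hd
      obtain ⟨k, hk, he⟩ := hd.eq_smul hm.continuousOn hpos hc' hs1
      rw [hc, EReal.coe_le_coe_iff] at hsa
      exact ⟨k, hk, he s ⟨hs0.le, hsa⟩⟩
  refine ⟨by rw [e1]; exact mul_ne_zero hk hU, ?_⟩
  rw [logDer, e1, e2, mul_div_mul_left _ _ hk]

end FirstEigenfunction

end SemigroupBound

end

/-! ### The semigroup bound -/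

theorem theorem1p9 {H : Type*} [NormedAddCommGroup H] [InnerProductSpace ℂ H] [CompleteSpace H]
    (S : ℝ → H →L[ℂ] H) (hS : SemigroupBound.IsC0Semigroup S)
    (m : ℝ → ℝ) (hm : ContDiffOn ℝ 1 m (Ici 0)) (hm_pos : ∀ t : ℝ, 0 ≤ t → 0 < m t)
    (hSm : ∀ t : ℝ, 0 ≤ t → ‖S t‖ ≤ m t)
    (hω : SemigroupBound.omegaOne (SemigroupBound.generator S) < ((0 : ℝ) : EReal))
    (hr : SemigroupBound.resolventRate (SemigroupBound.generator S) 0 = 1) :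
    0 < SemigroupBound.aStar m ∧
    (∃ u₀ du₀ : ℝ → ℝ, SemigroupBound.IsFirstEigenfunction m u₀ du₀) ∧
    (∀ u₀ du₀ : ℝ → ℝ, SemigroupBound.IsFirstEigenfunction m u₀ du₀ →
      (∀ s : ℝ, 0 < s → (s : EReal) ≤ SemigroupBound.aStar m →
        u₀ s ≠ 0 ∧ 0 < SemigroupBound.logDer u₀ du₀ s) ∧
      ∀ a b t : ℝ, 0 < a → (a : EReal) ≤ SemigroupBound.aStar m →
        0 < b → (b : EReal) ≤ SemigroupBound.aStar m → a + b < t →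
        ‖((Real.exp t : ℝ) : ℂ) • S t‖ ≤
          Real.exp (a + b) * m a * m b *
            √(SemigroupBound.logDer u₀ du₀ a) * √(SemigroupBound.logDer u₀ du₀ b)) ∧
    (∀ c : ℝ, SemigroupBound.aStar m = (c : EReal) → ∀ t : ℝ, 2 * c < t →
      ‖((Real.exp t : ℝ) : ℂ) • S t‖ ≤ Real.exp (2 * c) * m c ^ 2) := by
  have hMpos := SemigroupBound.extendLeft_pos hm_pos
  have hM := SemigroupBound.continuous_extendLeft hm.continuousOn
  have hSM : ∀ t, 0 ≤ t → ‖S t‖ ≤ SemigroupBound.extendLeft m t := fun t ht => by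
    rw [SemigroupBound.extendLeft_of_nonneg m ht]
    exact hSm t ht
  obtain ⟨θ, hθ0, hθ⟩ := SemigroupBound.exists_pruefer hM hMpos 1
  obtain ⟨U, P, hs⟩ : ∃ U P, SemigroupBound.IsSolution (SemigroupBound.extendLeft m) 1 U P :=
    ⟨_, _, SemigroupBound.isSolution_of_pruefer hM hMpos hθ0 hθ⟩
  have hpos : ∀ {a : ℝ}, (a : EReal) ≤ SemigroupBound.aStar m → ∀ t, 0 < t → t ≤ a →
      0 < U t ∧ SemigroupBound.extendLeft m t ^ 2 * U t ≤ P t := fun ha t ht hta =>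
    SemigroupBound.pos_of_le_aStar hm hm_pos hs ht ((EReal.coe_le_coe_iff.2 hta).trans ha)
  have hfirst := hs.isFirstEigenfunction hm hm_pos
  have hlog : ∀ {u₀ du₀ : ℝ → ℝ}, SemigroupBound.IsFirstEigenfunction m u₀ du₀ → ∀ {s : ℝ}, 0 < s →
      (s : EReal) ≤ SemigroupBound.aStar m → 0 < SemigroupBound.logDer u₀ du₀ s ∧
        √(P s / U s) = m s * √(SemigroupBound.logDer u₀ du₀ s) := by
    intro u₀ du₀ h s hs0 hsa
    obtain ⟨hU, hP⟩ := hpos hsa s hs0 le_rfl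
    have hm0 := hm_pos s hs0.le
    have hP0 : 0 < P s := (mul_pos (pow_pos (hMpos s) 2) hU).trans_le hP
    rw [(h.logDer_eq hm hm_pos hs hs0 hsa).2]
    refine ⟨by positivity, ?_⟩
    rw [show P s / U s = m s ^ 2 * (P s / m s ^ 2 / U s) by field_simp,
      Real.sqrt_mul (by positivity), Real.sqrt_sq hm0.le]
  have hbound : ∀ u₀ du₀ : ℝ → ℝ, SemigroupBound.IsFirstEigenfunction m u₀ du₀ →
      ∀ a b t : ℝ, 0 < a → (a : EReal) ≤ SemigroupBound.aStar m →
        0 < b → (b : EReal) ≤ SemigroupBound.aStar m → a + b < t →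
        ‖((Real.exp t : ℝ) : ℂ) • S t‖ ≤ Real.exp (a + b) * m a * m b *
          √(SemigroupBound.logDer u₀ du₀ a) * √(SemigroupBound.logDer u₀ du₀ b) := by
    intro u₀ du₀ h a b t ha haa hb hba hab
    have key := SemigroupBound.norm_le_of_resolvent_le_one hS hM hMpos hSM hs
      (SemigroupBound.exists_resolvent_norm_le_one hω hr) ha hb hab (hpos haa) (hpos hba)
    rw [(hlog h ha haa).2, (hlog h hb hba).2] at key
    rw [norm_smul, Complex.norm_real, Real.norm_eq_abs, Real.abs_exp]
    refine (mul_le_mul_of_nonneg_left key (Real.exp_pos t).le).trans (le_of_eq ?_)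
    rw [← mul_assoc, ← Real.exp_add, show t + -(t - a - b) = a + b by ring]
    ring
  refine ⟨SemigroupBound.aStar_pos hm hm_pos hs, ⟨_, _, hfirst⟩, fun u₀ du₀ h =>
    ⟨fun s hs0 hsa => ⟨(h.logDer_eq hm hm_pos hs hs0 hsa).1, (hlog h hs0 hsa).1⟩,
      hbound u₀ du₀ h⟩, fun c hc t ht => ?_⟩
  have hc0 : 0 < c := by
    have := SemigroupBound.aStar_pos hm hm_pos hs
    rw [hc] at this
    exact EReal.coe_pos.1 this
  -- the Robin condition at `a*` says that the logarithmic derivative there is `1`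
  have hψ : SemigroupBound.logDer U (fun s => P s / SemigroupBound.extendLeft m s ^ 2) c = 1 := by
    have hrobin : P c / SemigroupBound.extendLeft m c ^ 2 = U c := (hfirst.1 c hc).2
    rw [SemigroupBound.logDer, hrobin]
    exact div_self (hpos hc.ge c hc0 le_rfl).1.ne'
  have := hbound _ _ hfirst c c t hc0 hc.ge hc0 hc.ge (by linarith)
  rw [hψ, Real.sqrt_one, mul_one, mul_one, ← two_mul] at this
  rwa [sq, ← mul_assoc]
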